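/- Let $U_\hbar$ be the $\hbar$-adically complete $\mathbb{Q}[[\hbar]]$-algebra topologically generated by $H,E,F$ with relations $$HE-EH=2E,\qquad HF-FH=-2F,\qquad EF-FE=\frac{K-K^{-1}}{q^{1/2}-q^{-1/2}},\qquad q=\exp\hbar,\quad K=\exp\tfrac{\hbar H}{2},$$ and let $U_\hbar^{\hat\otimes l}$ be its $\hbar$-adically completed $l$-fold tensor power over $\mathbb{Q}[[\hbar]]$. Put $D=\exp(\frac{\hbar}{4}H\otimes H)$, $[n]_q=\frac{q^n-1}{q-1}$, $[n]_q!=[n]_q\cdots[1]_q$, and $$R=D\sum_{n\ge 0}q^{\frac12 n(n-1)}q^{-\frac n2}\frac{(q-1)^n}{[n]_q!}F^n\otimes E^n,\qquad R^{-1}=\Big(\sum_{n\ge 0}(-1)^nq^{-\frac n2}\frac{(q-1)^n}{[n]_q!}F^n\otimes E^n\Big)D^{-1}.$$ For $y=\sum y_1\otimes\cdots\otimes y_n$ and indices $j_1,\dots,j_n\in\{1,\dots,l\}$ write $y^{(l)}_{j_1\cdots j_n}=\sum (y_1)^{(l)}_{j_1}\cdots(y_n)^{(l)}_{j_n}\in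 U_\hbar^{\hat\otimes l}$, where $x^{(l)}_i$ has $x$ in the $i$th tensorand and $1$ elsewhere. Let $\sigma_1,\dots,\sigma_{l-1}$ be the standard (Artin) generators of the braid group on $l$ strands. A word in the $\sigma_i^{\pm1}$ is viewed as a braid diagram whose rightmost letter is on top, with all strands oriented downwards and $\sigma_i$ a positive crossing. The universal $sl_2$ invariant $J(\beta)\in U_\hbar^{\hat\otimes l}$ of a pure braid $\beta$ is computed from any such diagram of $\beta$, as the product over its crossings, taken from bottom to top and written from left to right, of the following factors: if the strands $a$ and $b$ enter the crossing from above on the left and on the right respectively, a positive crossing contributes $R^{(l)}_{ab}$ and a negative crossing contributes $(R^{-1})^{(l)}_{ba}$. For $1\le i<j\le l$ let $A_{i,j}=A_{j,i}=\sigma_{j-1}\cdots\sigma_{i+1}\sigma_i^2\sigma_{i+1}^{-1}\cdots\sigma_{j-1}^{-1}$. For $m\ge1$ let $\mathcal{I}_{m+1}$ be the set of sequences $J=j_1\cdots j_{m+1}$ of pairwise distinct elements of $\{1,\dots,l\}$ such that $j_i<j_m<j_{m+1}$ for all $i\le m-1$. For $J\in\mathcal{I}_{m+1}$ let $$B_J=[[\cdots[[A_{j_1,j_2},A_{j_2,j_3}],A_{j_3,j_4}],\cdots],A_{j_m,j_{m+1}}],\qquad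 [x,y]=xyx^{-1}y^{-1}$$ (so $B_J=A_{j_1,j_2}$ if $m=1$). Finally, let $sl_2$ be the Lie algebra over $\mathbb{Q}$ with basis $h,e,f$ and $[h,e]=2e$, $[h,f]=-2f$, $[e,f]=h$. Put $\varsigma_2=\frac12h\otimes h+f\otimes e+e\otimes f$ and $\varsigma_{m+1}=(1^{\otimes m-1}\otimes s)(\varsigma_m)\in sl_2^{\otimes m+1}$ for $m\ge2$, where $s(a)=\frac12[a,h]\otimes h+[a,f]\otimes e+[a,e]\otimes f$; and let $\varsigma^{(l)}_J=(\varsigma_{m+1})^{(l)}_{j_1\cdots j_{m+1}}$, where $h,e,f$ are read as $H,E,F$. **Proposition.** For all $l$, all $m\ge1$ and all $J\in\mathcal{I}_{m+1}$, $$J(B_J)\equiv 1+\varsigma^{(l)}_J\,\hbar^m \pmod{\hbar^{m+1}U_\hbar^{\hat\otimes l}}.$$ That is, the congruence holds for the value computed from every braid diagram of $B_J$. -/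

import Mathlib

open scoped TensorProduct

noncomputable section

namespace UniversalSl2

/-! ### The base ring and `ħ`-adic completion -/

/-- The base ring `ℚ[[ħ]]`. -/
abbrev Qh : Type := PowerSeries ℚ

/-- The formal parameter `ħ`. -/
abbrev hbar : Qh := PowerSeries.X

section Completion

variable (A : Type) [Ring A] [Algebra Qh A]

/-- The two-sided ideal `ħⁿ A` of a `ℚ[[ħ]]`-algebra `A`. -/
def hIdeal (n : ℕ) : Ideal A := Ideal.span {algebraMap Qh A (hbar ^ n)}

instance hIdeal_isTwoSided (n : ℕ) : (hIdeal A n).IsTwoSided := by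
  refine ⟨fun {a} b ha => ?_⟩
  obtain ⟨c, rfl⟩ := Ideal.mem_span_singleton'.mp ha
  refine Ideal.mem_span_singleton'.mpr ⟨c * b, ?_⟩
  rw [mul_assoc, mul_assoc, Algebra.commutes]

theorem hIdeal_succ_le (n : ℕ) : hIdeal A (n + 1) ≤ hIdeal A n := by
  refine Ideal.span_le.mpr ?_
  rintro _ rfl
  refine Ideal.mem_span_singleton'.mpr ⟨algebraMap Qh A hbar, ?_⟩
  rw [← map_mul, pow_succ']

/-- Coherent sequences in `∏ₙ A / ħⁿ A`. -/
def coherent : Subalgebra Qh ((n : ℕ) → A ⧸ hIdeal A n) where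
  carrier := {x | ∀ n, Ideal.Quotient.factor (hIdeal_succ_le A n) (x (n + 1)) = x n}
  mul_mem' hx hy n := by
    rw [Pi.mul_apply, map_mul, hx n, hy n, Pi.mul_apply]
  add_mem' hx hy n := by
    rw [Pi.add_apply, map_add, hx n, hy n, Pi.add_apply]
  algebraMap_mem' _ _ := rfl

/-- The `ħ`-adic completion `lim A / ħⁿ A` of a (not necessarily commutative)
`ℚ[[ħ]]`-algebra `A`. -/
def HCompletion : Type := coherent A

instance : Ring (HCompletion A) := inferInstanceAs (Ring (coherent A))

instance : Algebra Qh (HCompletion A) := inferInstanceAs (Algebra Qh (coherent A))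

instance : Algebra ℚ (HCompletion A) :=
  Algebra.compHom (HCompletion A) (PowerSeries.C : ℚ →+* Qh)

instance : IsScalarTower ℚ Qh (HCompletion A) :=
  IsScalarTower.of_algebraMap_eq fun _ => rfl

/-- The canonical homomorphism from `A` to its `ħ`-adic completion. -/
def toCompletion : A →ₐ[Qh] HCompletion A where
  toFun a := ⟨fun _ => Ideal.Quotient.mk _ a, fun _ => rfl⟩
  map_one' := rfl
  map_mul' _ _ := rfl
  map_zero' := rfl
  map_add' _ _ := rfl
  commutes' _ := rfl

variable {A}

/-- The convergent series `∑ₖ ħᵏ aₖ` in the `ħ`-adic completion of `A`; modulo `ħⁿ` it is the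
finite sum over `k < n`. -/
def hSum (a : ℕ → A) : HCompletion A :=
  ⟨fun n => Ideal.Quotient.mk _ (∑ k ∈ Finset.range n, (hbar ^ k : Qh) • a k), fun n => by
    rw [Ideal.Quotient.factor_mk, Finset.sum_range_succ, map_add, add_eq_left,
      Ideal.Quotient.eq_zero_iff_mem, Algebra.smul_def, Algebra.commutes]
    exact Ideal.mul_mem_left _ _ (Ideal.mem_span_singleton_self _)⟩

end Completion

/-- Congruence modulo `ħⁿ` in a `ℚ[[ħ]]`-algebra: `x - y ∈ ħⁿ A`. -/
def CongrModH {A : Type} [Ring A] [Algebra Qh A] (n : ℕ) (x y : A) : Prop :=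
  ∃ z : A, x - y = (hbar ^ n : Qh) • z

/-! ### The quantized enveloping algebra `U_ħ(sl₂)` -/

/-- The three generators. -/
inductive Gen : Type
  | H | E | F

/-- The `ħ`-adically completed free `ℚ[[ħ]]`-algebra on `H, E, F`. -/
abbrev FreeHat : Type := HCompletion (FreeAlgebra Qh Gen)

/-- A generator, as an element of the completed free algebra. -/
def FreeHat.gen (x : Gen) : FreeHat := toCompletion _ (FreeAlgebra.ι Qh x)

/-- The coefficient of `ħᵏ Hᵏ` in `K - K⁻¹ = exp(ħH/2) - exp(-ħH/2)`, which is also the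
coefficient of `ħᵏ` in `q^{1/2} - q^{-1/2} = exp(ħ/2) - exp(-ħ/2)`. -/
def sinhCoeff (k : ℕ) : ℚ := ((1 / 2) ^ k - (-1 / 2) ^ k) / (k.factorial : ℚ)

/-- `(q^{1/2} - q^{-1/2}) / ħ`, a unit of `ℚ[[ħ]]` (its constant term is `1`). -/
def qDiff : Qh := PowerSeries.mk fun k => sinhCoeff (k + 1)

/-- `(K - K⁻¹) / (q^{1/2} - q^{-1/2})`: numerator and denominator are both divided by `ħ`, that
is, it is `((q^{1/2} - q^{-1/2}) / ħ)⁻¹` times `(K - K⁻¹) / ħ = ∑ₖ ħᵏ sinhCoeff (k+1) Hᵏ⁺¹`. -/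
def FreeHat.commEF : FreeHat :=
  qDiff⁻¹ • hSum fun k =>
    (PowerSeries.C (sinhCoeff (k + 1)) : Qh) • (FreeAlgebra.ι Qh Gen.H) ^ (k + 1)

open FreeHat in
/-- The defining relations of `U_ħ(sl₂)`. -/
inductive UhRel : FreeHat → FreeHat → Prop
  | HE : UhRel (gen .H * gen .E - gen .E * gen .H) (2 * gen .E)
  | HF : UhRel (gen .H * gen .F - gen .F * gen .H) (-(2 * gen .F))
  | EF : UhRel (gen .E * gen .F - gen .F * gen .E) commEF

/-- `U_ħ(sl₂)`: the `ħ`-adically complete `ℚ[[ħ]]`-algebra topologically generated by `H, E, F`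
with the relations `UhRel`.  (Completing the quotient by the relations amounts to dividing
the completed free algebra by the `ħ`-adic closure of the ideal they generate.) -/
abbrev Uh : Type := HCompletion (RingQuot UhRel)

/-- The generators of `U_ħ(sl₂)`. -/
def Uh.gen (x : Gen) : Uh := toCompletion _ (RingQuot.mkAlgHom Qh UhRel (FreeHat.gen x))

/-! ### Completed tensor powers -/

/-- The algebraic tensor power `U_ħ^{⊗ l}` over `ℚ[[ħ]]`. -/
abbrev UhTensor (l : ℕ) : Type := ⨂[Qh] _i : Fin l, Uh

/-- The completed tensor power `U_ħ^{⊗̂ l}`. -/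
abbrev UhHat (l : ℕ) : Type := HCompletion (UhTensor l)

/-- `x ↦ 1 ⊗ ⋯ ⊗ x ⊗ ⋯ ⊗ 1` with `x` at the `i`th position. -/
def inTensor (l : ℕ) (i : Fin l) : Uh →ₐ[Qh] UhTensor l :=
  PiTensorProduct.singleAlgHom (R := Qh) (A := fun _ : Fin l => Uh) i

/-- `x ↦ x_i^{(l)} = 1 ⊗ ⋯ ⊗ x ⊗ ⋯ ⊗ 1 ∈ U_ħ^{⊗̂ l}`. -/
def inHat (l : ℕ) (i : Fin l) : Uh →ₐ[Qh] UhHat l :=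
  (toCompletion (UhTensor l)).comp (inTensor l i)

/-! ### The universal `R`-matrix -/

/-- `q = exp ħ`. -/
def q : Qh := PowerSeries.exp ℚ

/-- `q^{-1/2} = exp (-ħ/2)`. -/
def qInvHalf : Qh := PowerSeries.rescale (-1 / 2 : ℚ) (PowerSeries.exp ℚ)

/-- `(q - 1) / ħ`. -/
def qSubOneDiv : Qh := PowerSeries.mk fun k => 1 / ((k + 1).factorial : ℚ)

/-- `[n]_q = (qⁿ - 1) / (q - 1) = 1 + q + ⋯ + qⁿ⁻¹`. -/
def qInt (n : ℕ) : Qh := ∑ k ∈ Finset.range n, q ^ k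

/-- `[n]_q! = [n]_q [n-1]_q ⋯ [1]_q`, a power series with constant term `n!`. -/
def qFactorial (n : ℕ) : Qh := ∏ k ∈ Finset.range n, qInt (k + 1)

/-- `ħⁿ` times this is `q^{n(n-1)/2} q^{-n/2} (q-1)ⁿ / [n]_q!`. -/
def rCoeff (n : ℕ) : Qh := q ^ (n.choose 2) * qInvHalf ^ n * qSubOneDiv ^ n * (qFactorial n)⁻¹

/-- `ħⁿ` times this is `(-1)ⁿ q^{-n/2} (q-1)ⁿ / [n]_q!`. -/
def rInvCoeff (n : ℕ) : Qh := (-1) ^ n * qInvHalf ^ n * qSubOneDiv ^ n * (qFactorial n)⁻¹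

/-- `exp (t ħ H_i H_j)`, where `H_i` is `H` in the `i`th tensorand. -/
def expHH (l : ℕ) (t : ℚ) (i j : Fin l) : UhHat l :=
  hSum fun k => (PowerSeries.C (t ^ k / (k.factorial : ℚ)) : Qh) •
    ((inTensor l i (Uh.gen .H)) ^ k * (inTensor l j (Uh.gen .H)) ^ k)

/-- `R = D ∑ₙ q^{n(n-1)/2} q^{-n/2} (q-1)ⁿ / [n]_q! Fⁿ ⊗ Eⁿ` with `D = exp (ħ/4 H ⊗ H)`, its first
tensorand placed at `i` and its second tensorand at `j` (for `i ≠ j`). -/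
def rMatrix (l : ℕ) (i j : Fin l) : UhHat l :=
  expHH l (1 / 4) i j * hSum fun n => rCoeff n •
    ((inTensor l i (Uh.gen .F)) ^ n * (inTensor l j (Uh.gen .E)) ^ n)

/-- `R⁻¹ = (∑ₙ (-1)ⁿ q^{-n/2} (q-1)ⁿ / [n]_q! Fⁿ ⊗ Eⁿ) D⁻¹`, its first tensorand placed at `i` and
its second tensorand at `j` (for `i ≠ j`). -/
def rMatrixInv (l : ℕ) (i j : Fin l) : UhHat l :=
  (hSum fun n => rInvCoeff n •
    ((inTensor l i (Uh.gen .F)) ^ n * (inTensor l j (Uh.gen .E)) ^ n)) * expHH l (-1 / 4) i j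

/-! ### Braids -/

/-- Artin's relations for generators `σ_i` indexed by `Fin (l - 1)`. -/
def braidRels (l : ℕ) : Set (FreeGroup (Fin (l - 1))) :=
  {r | (∃ i j : Fin (l - 1), i.val + 2 ≤ j.val ∧
      r = FreeGroup.of i * FreeGroup.of j * (FreeGroup.of j * FreeGroup.of i)⁻¹) ∨
    (∃ i j : Fin (l - 1), i.val + 1 = j.val ∧
      r = FreeGroup.of i * FreeGroup.of j * FreeGroup.of i *
        (FreeGroup.of j * FreeGroup.of i * FreeGroup.of j)⁻¹)}

/-- The braid group on `l` strands. -/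
abbrev BraidGroup (l : ℕ) : Type := PresentedGroup (braidRels l)

/-- A braid diagram: a word in the letters `σ_i` (coded `(i, true)`) and `σ_i⁻¹`
(coded `(i, false)`).  A word is drawn with its rightmost letter on top; all strands are oriented
downwards, and `σ_i` is a positive crossing of the strands at the positions `i` and `i + 1`. -/
abbrev BraidWord (l : ℕ) : Type := List (Fin (l - 1) × Bool)

/-- The braid represented by a diagram. -/
def BraidWord.toBraid {l : ℕ} (w : BraidWord l) : BraidGroup l :=
  PresentedGroup.mk (braidRels l) (FreeGroup.mk w)

/-- The generator `σ_k` (positions are counted from `0`, and `k + 1 < l` is intended). -/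
def sigma (l k : ℕ) : BraidGroup l :=
  if hk : k < l - 1 then PresentedGroup.of (rels := braidRels l) ⟨k, hk⟩ else 1

/-- `σ_{j-1} ⋯ σ_{i+1} σ_i² σ_{i+1}⁻¹ ⋯ σ_{j-1}⁻¹` for `i < j`. -/
def pureGenAux (l i j : ℕ) : BraidGroup l :=
  let g : BraidGroup l := ((List.range (j - 1 - i)).map fun t => sigma l (j - 1 - t)).prod
  g * sigma l i ^ 2 * g⁻¹

/-- The pure braid generator `A_{i,j}`, with `A_{i,j} = A_{j,i}` for `i > j`. -/
def pureGen {l : ℕ} (i j : Fin l) : BraidGroup l :=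
  if i < j then pureGenAux l i j else pureGenAux l j i

/-- The set of sequences `j_1 … j_n` of non-repeating indices with
`j_i < j_{n-1} < j_n` for `i ≤ n - 2`. -/
def indexSet (l n : ℕ) : Set (Fin n → Fin l) :=
  {J | Function.Injective J ∧ ∀ a b : Fin n, a < b → n ≤ b.val + 2 → J a < J b}

/-- `B_J = [[…[A_{j_1 j_2}, A_{j_2 j_3}], …], A_{j_m j_{m+1}}]` for `J = j_1 … j_{m+1}`, `m ≥ 1`,
with `[x, y] = x y x⁻¹ y⁻¹`.  (The value at `m = 0` plays no role.) -/
def commBraid {l : ℕ} : (m : ℕ) → (Fin (m + 1) → Fin l) → BraidGroup l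
  | 0, _ => 1
  | 1, J => pureGen (J 0) (J 1)
  | m + 2, J =>
    let x := commBraid (m + 1) (fun i => J i.castSucc)
    let y := pureGen (J (Fin.last (m + 1)).castSucc) (J (Fin.last (m + 2)))
    x * y * x⁻¹ * y⁻¹

/-! ### The universal `sl₂` invariant -/

/-- The left one of the two positions of the crossing `σ_i`. -/
def leftPos {l : ℕ} (i : Fin (l - 1)) : Fin l := ⟨i.val, by omega⟩

/-- The right one of the two positions of the crossing `σ_i`. -/
def rightPos {l : ℕ} (i : Fin (l - 1)) : Fin l := ⟨i.val + 1, by omega⟩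

/-- `strandAt w p` is the strand which arrives at position `p` at the bottom of the diagram `w`;
strands are numbered by their upper end points. -/
def strandAt {l : ℕ} : BraidWord l → Equiv.Perm (Fin l)
  | [] => 1
  | (i, _) :: w => strandAt w * Equiv.swap (leftPos i) (rightPos i)

/-- The universal `sl₂` invariant computed from a braid diagram.  The labels on each strand are
read from bottom to top and written from left to right, so the bottom letter contributes the
leftmost factor.  If the strands `a` and `b` enter a crossing from above on the left and on the
right, respectively, then a positive crossing carries `R` with its first tensorand on `a`
and its second one on `b`, and a negative crossing carries `R⁻¹` with its first tensorand on `b`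
and its second one on `a`. -/
def universalInvariant {l : ℕ} : BraidWord l → UhHat l
  | [] => 1
  | (i, true) :: w =>
    rMatrix l (strandAt w (leftPos i)) (strandAt w (rightPos i)) * universalInvariant w
  | (i, false) :: w =>
    rMatrixInv l (strandAt w (rightPos i)) (strandAt w (leftPos i)) * universalInvariant w

/-! ### The tensors `ς_m` -/

/-- The Lie algebra `sl₂` over `ℚ`. -/
abbrev Sl2 : Type := LieAlgebra.SpecialLinear.sl (Fin 2) ℚ

/-- The standard basis element `e`. -/
def sl2e : Sl2 := ⟨!![0, 1; 0, 0], LinearMap.mem_ker.mpr (by simp [Matrix.trace_fin_two_of])⟩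

/-- The standard basis element `f`. -/
def sl2f : Sl2 := ⟨!![0, 0; 1, 0], LinearMap.mem_ker.mpr (by simp [Matrix.trace_fin_two_of])⟩

/-- The standard basis element `h`. -/
def sl2h : Sl2 := ⟨!![1, 0; 0, -1], LinearMap.mem_ker.mpr (by simp [Matrix.trace_fin_two_of])⟩

/-- The linear map `a ↦ a ⊗ b` from `sl₂` to `sl₂^{⊗ 2}`. -/
def tensorRight (b : Sl2) : Sl2 →ₗ[ℚ] (⨂[ℚ]^2) Sl2 where
  toFun a := PiTensorProduct.tprod ℚ ![a, b]
  map_add' x y := by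
    have := (PiTensorProduct.tprod ℚ (s := fun _ : Fin 2 => Sl2)).cons_add ![b] x y
    simpa using this
  map_smul' t x := by
    have := (PiTensorProduct.tprod ℚ (s := fun _ : Fin 2 => Sl2)).cons_smul ![b] t x
    simpa using this

/-- `c = 1/2 h ⊗ h + f ⊗ e + e ⊗ f`. -/
def casimir : (⨂[ℚ]^2) Sl2 :=
  (1 / 2 : ℚ) • tensorRight sl2h sl2h + tensorRight sl2e sl2f + tensorRight sl2f sl2e

/-- The linear map `a ↦ [a, b]` on `sl₂`. -/
def bracketRight (b : Sl2) : Sl2 →ₗ[ℚ] Sl2 where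
  toFun a := ⁅a, b⁆
  map_add' x y := add_lie x y b
  map_smul' t x := smul_lie t x b

/-- `s(a) = (ad ⊗ 1)(a ⊗ c) = 1/2 [a,h] ⊗ h + [a,f] ⊗ e + [a,e] ⊗ f`. -/
def sMap : Sl2 →ₗ[ℚ] (⨂[ℚ]^2) Sl2 :=
  (1 / 2 : ℚ) • (tensorRight sl2h ∘ₗ bracketRight sl2h) +
    tensorRight sl2e ∘ₗ bracketRight sl2f + tensorRight sl2f ∘ₗ bracketRight sl2e

/-- `1^{⊗ n} ⊗ s : sl₂^{⊗ (n+1)} → sl₂^{⊗ (n+2)}`. -/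
def sLast (n : ℕ) : (⨂[ℚ]^(n + 1)) Sl2 →ₗ[ℚ] (⨂[ℚ]^(n + 2)) Sl2 :=
  (TensorPower.mulEquiv (R := ℚ) (M := Sl2) (n := n) (m := 2)).toLinearMap ∘ₗ
    TensorProduct.map LinearMap.id
      (sMap ∘ₗ (PiTensorProduct.subsingletonEquiv (s := fun _ : Fin 1 => Sl2) (0 : Fin 1)).toLinearMap) ∘ₗ
    (TensorPower.mulEquiv (R := ℚ) (M := Sl2) (n := n) (m := 1)).symm.toLinearMap

/-- `varsigma m` is the tensor `ς_{m+1} ∈ sl₂^{⊗ (m+1)}`, for `m ≥ 1`: `ς_2 = c` and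
`ς_{m+2} = (1^{⊗ m} ⊗ s)(ς_{m+1})`.  (The value at `m = 0` plays no role.) -/
def varsigma : (m : ℕ) → (⨂[ℚ]^(m + 1)) Sl2
  | 0 => 0
  | 1 => casimir
  | m + 2 => sLast (m + 1) (varsigma (m + 1))

/-- The linear map `sl₂ → U_ħ` with `h ↦ H`, `e ↦ E`, `f ↦ F`. -/
def sl2ToUh : Sl2 →ₗ[ℚ] Uh where
  toFun x := x.val 0 0 • Uh.gen .H + x.val 0 1 • Uh.gen .E + x.val 1 0 • Uh.gen .F
  map_add' x y := by
    have hadd : ∀ i j, (x + y).val i j = x.val i j + y.val i j := fun _ _ => rfl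
    rw [hadd, hadd, hadd, add_smul, add_smul, add_smul]
    abel
  map_smul' t x := by
    have hsmul : ∀ i j, (t • x).val i j = t * x.val i j := fun _ _ => rfl
    rw [hsmul, hsmul, hsmul, mul_smul, mul_smul, mul_smul, RingHom.id_apply, smul_add, smul_add]

/-- `y ↦ y^{(l)}_{j_1 … j_n}`: the linear map `sl₂^{⊗ n} → U_ħ^{⊗̂ l}` sending
`x_1 ⊗ ⋯ ⊗ x_n` to `(x_1)^{(l)}_{j_1} ⋯ (x_n)^{(l)}_{j_n}`. -/
def place (l : ℕ) {n : ℕ} (J : Fin n → Fin l) : (⨂[ℚ]^n) Sl2 →ₗ[ℚ] UhHat l :=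
  PiTensorProduct.lift
    ((MultilinearMap.mkPiAlgebraFin ℚ n (UhHat l)).compLinearMap fun p =>
      ((inHat l (J p)).toLinearMap.restrictScalars ℚ) ∘ₗ sl2ToUh)

end UniversalSl2

end

/-!
The congruence has two ingredients: the value computed from a word depends only on the braid, and
the invariant of a commutator has an easily computed leading term.

*Invariance.*  The completed tensor power is not known to be torsion free, so every identity in it
is checked in the quotients by `ħᴺ` (`ext_level`), where all series become finite sums.  There the
`R`-matrix is `D · e(F ⊗ E)`, with `D = exp (ħ/4 H ⊗ H)` and `e = qexp` a `q`-exponential.  The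
`q`-binomial theorem (`qexp_add`) gives `(Δ ⊗ 1)(R) = R₁₃ R₂₃` with `Δ(F) = F ⊗ K⁻¹ + 1 ⊗ F`
(`QuantumTriples.rElt_mul_rElt`), and the commutator `[Eⁿ⁺¹, F]` gives `R Δ(F) = Δᵒᵖ(F) R`
(`QuantumTriples.rElt_mul_deltaF`).  Moving `R₁₂` through `(Δ ⊗ 1)(R)` yields the Yang–Baxter
equation (`QuantumTriples.yangBaxter`); the coproduct is needed on `F` alone, and only as an explicit
element.  Consequently the braid group acts on pairs of a permutation and an element of the
completed tensor power (`braidAction`), and the universal invariant of a word is the second component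
of the image of `(1, 1)` (`braidAction_toBraid`).

*Leading terms.*  Since `R ≡ 1 + ħ (¼ H ⊗ H + F ⊗ E)` modulo `ħ²`, the invariant of `A_{i,j}` is
`1 + ħ c_{ij}` modulo `ħ²`, where `c` is the Casimir tensor; conjugation by `σ_k` only relabels the
strands to this order (`pureGen_congr`).  On pure braids the invariant is multiplicative, and the group commutator
of `1 + ħᵐ a` and `1 + ħ b` is `1 + ħᵐ⁺¹ [a, b]` to leading order (`CongrModH.commutator`).  Modulo
`ħ` the relations of `U_ħ` are those of `sl₂`, so commutation with `c` in the last two tensorands is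
`1^{⊗ n} ⊗ s` (`commutator_place`).  Induction on `m` finishes the proof (`commBraid_congr`).
-/

noncomputable section

namespace UniversalSl2

/-! ### The coefficients of the universal `R`-matrix -/

section BaseRing

/-- `q^{1/2} = exp (ħ/2)`. -/
def qHalf : Qh := PowerSeries.rescale (1 / 2 : ℚ) (PowerSeries.exp ℚ)

theorem qHalf_mul_qHalf : qHalf * qHalf = q := by
  rw [qHalf, PowerSeries.exp_mul_exp_eq_exp_add, q]
  norm_num [PowerSeries.rescale_one]

theorem qInvHalf_mul_qHalf : qInvHalf * qHalf = 1 := by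
  rw [qHalf, qInvHalf, PowerSeries.exp_mul_exp_eq_exp_add]
  norm_num [PowerSeries.rescale_zero]

theorem hbar_mul_qSubOneDiv : hbar * qSubOneDiv = q - 1 := by
  ext n
  rw [PowerSeries.X_mul]
  cases n with
  | zero => simp [q]
  | succ n =>
    rw [PowerSeries.coeff_succ_mul_X]
    simp [q, qSubOneDiv, PowerSeries.coeff_exp, PowerSeries.coeff_one]

theorem hbar_mul_qDiff : hbar * qDiff = qHalf - qInvHalf := by
  ext n
  rw [PowerSeries.X_mul]
  cases n with
  | zero =>
    rw [PowerSeries.coeff_zero_mul_X, map_sub, qHalf, qInvHalf, PowerSeries.coeff_rescale,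
      PowerSeries.coeff_rescale, pow_zero, pow_zero, sub_self]
  | succ n =>
    rw [PowerSeries.coeff_succ_mul_X]
    simp [qHalf, qInvHalf, qDiff, sinhCoeff, PowerSeries.coeff_exp]
    ring

theorem hbar_ne_zero : hbar ≠ 0 := PowerSeries.X_ne_zero

theorem qInvHalf_mul_qSubOneDiv : qInvHalf * qSubOneDiv = qDiff := by
  refine mul_left_cancel₀ hbar_ne_zero ?_
  rw [mul_left_comm, hbar_mul_qSubOneDiv, hbar_mul_qDiff, ← qHalf_mul_qHalf]
  linear_combination qHalf * qInvHalf_mul_qHalf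

theorem constantCoeff_q : PowerSeries.constantCoeff q = 1 := by
  simp [q]

theorem constantCoeff_qInt (n : ℕ) : PowerSeries.constantCoeff (qInt n) = n := by
  simp [qInt, constantCoeff_q]

theorem constantCoeff_qFactorial (n : ℕ) :
    PowerSeries.constantCoeff (qFactorial n) = n.factorial := by
  simp only [qFactorial, map_prod, constantCoeff_qInt]
  exact_mod_cast Finset.prod_range_add_one_eq_factorial n

theorem isUnit_qInt_succ (n : ℕ) : IsUnit (qInt (n + 1)) := by
  rw [PowerSeries.isUnit_iff_constantCoeff, constantCoeff_qInt, isUnit_iff_ne_zero]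
  exact_mod_cast n.succ_ne_zero

theorem qInt_zero : qInt 0 = 0 := by simp [qInt]

theorem qInt_add (m n : ℕ) : qInt (m + n) = qInt m + q ^ m * qInt n := by
  simp [qInt, Finset.sum_range_add, Finset.mul_sum, pow_add]

theorem qFactorial_succ (n : ℕ) : qFactorial (n + 1) = qFactorial n * qInt (n + 1) := by
  rw [qFactorial, Finset.prod_range_succ, ← qFactorial]

theorem qInt_mul_inv_qFactorial (n : ℕ) :
    qInt (n + 1) * (qFactorial (n + 1))⁻¹ = (qFactorial n)⁻¹ := by
  have h0 : ∀ n, PowerSeries.constantCoeff (qFactorial n) ≠ 0 := fun n => by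
    rw [constantCoeff_qFactorial]
    exact_mod_cast n.factorial_ne_zero
  have h1 := PowerSeries.mul_inv_cancel _ (h0 (n + 1))
  have h2 := PowerSeries.mul_inv_cancel _ (h0 n)
  rw [qFactorial_succ] at h1 ⊢
  linear_combination (qFactorial n)⁻¹ * h1 - qInt (n + 1) * (qFactorial n * qInt (n + 1))⁻¹ * h2

theorem rCoeff_zero : rCoeff 0 = 1 := by
  simp [rCoeff, qFactorial]

theorem rInvCoeff_zero : rInvCoeff 0 = 1 := by
  simp [rInvCoeff, qFactorial]

/-- The recursion which characterises the coefficients of `R`. -/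
theorem qInt_mul_rCoeff_succ (n : ℕ) :
    qInt (n + 1) * rCoeff (n + 1) = q ^ n * qDiff * rCoeff n := by
  rw [rCoeff, rCoeff, ← qInvHalf_mul_qSubOneDiv, ← qInt_mul_inv_qFactorial n,
    Nat.choose_succ_succ' n 1, Nat.choose_one_right]
  ring

theorem qInt_mul_rInvCoeff_succ (n : ℕ) :
    qInt (n + 1) * rInvCoeff (n + 1) = -(qDiff * rInvCoeff n) := by
  rw [rInvCoeff, rInvCoeff, ← qInvHalf_mul_qSubOneDiv, ← qInt_mul_inv_qFactorial n]
  ring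

end BaseRing

/-! ### Exponential series in an algebra killed by a power of `ħ` -/

section Truncated

variable {B : Type*} [Ring B] [Algebra Qh B]

/-- The finite sum `∑ₖ ħᵏ uₖ` over `k < N`: the value of the series in an algebra killed
by `ħᴺ`. -/
def truncSum (N : ℕ) (u : ℕ → B) : B := ∑ k ∈ Finset.range N, (hbar ^ k : Qh) • u k

/-- The product of two truncated series is the truncated Cauchy product: the terms of degree at
least `N` vanish. -/
theorem truncSum_mul {N : ℕ} (hN : ∀ b : B, (hbar ^ N : Qh) • b = 0) (u v : ℕ → B) :
    truncSum N u * truncSum N v =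
      truncSum N fun p => ∑ x ∈ Finset.HasAntidiagonal.antidiagonal p, u x.1 * v x.2 := by
  have hvan : ∀ (k : ℕ) (b : B), N ≤ k → (hbar ^ k : Qh) • b = 0 := fun k b hk => by
    rw [← Nat.add_sub_cancel' hk, pow_add, mul_smul, hN]
  have hR : (truncSum N fun p => ∑ x ∈ Finset.HasAntidiagonal.antidiagonal p, u x.1 * v x.2) =
      ∑ p ∈ Finset.range N, ∑ k ∈ Finset.range (p + 1),
        (hbar ^ (k + (p - k)) : Qh) • (u k * v (p - k)) := by
    refine Finset.sum_congr rfl fun p _ => ?_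
    rw [Finset.smul_sum, Finset.Nat.sum_antidiagonal_eq_sum_range_succ_mk]
    refine Finset.sum_congr rfl fun k hk => ?_
    rw [Nat.add_sub_cancel' (Nat.lt_succ_iff.mp (Finset.mem_range.mp hk))]
  rw [hR, Finset.sum_range_diag_flip N fun k m => (hbar ^ (k + m) : Qh) • (u k * v m),
    truncSum, truncSum, Finset.sum_mul_sum]
  refine Finset.sum_congr rfl fun n _ => ?_
  refine (Finset.sum_subset (Finset.range_mono (Nat.sub_le N n)) fun m _ hm => ?_).symm.trans ?_
  · rw [Finset.mem_range, not_lt] at hm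
    rw [smul_mul_smul_comm, ← pow_add, hvan _ _ (by omega)]
  · refine Finset.sum_congr rfl fun m _ => ?_
    rw [smul_mul_smul_comm, ← pow_add]

theorem truncSum_mul_comm_of {N : ℕ} {u v : ℕ → B} {y : B} (h : ∀ k, u k * y = y * v k) :
    truncSum N u * y = y * truncSum N v := by
  rw [truncSum, truncSum, Finset.sum_mul, Finset.mul_sum]
  refine Finset.sum_congr rfl fun k _ => ?_
  rw [smul_mul_assoc, mul_smul_comm, h]

theorem truncSum_single_zero {N : ℕ} (hN : ∀ b : B, (hbar ^ N : Qh) • b = 0) {u : ℕ → B}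
    (h : ∀ k, u (k + 1) = 0) : truncSum N u = u 0 := by
  cases N with
  | zero =>
    have h0 := hN (u 0)
    rw [pow_zero, one_smul] at h0
    rw [truncSum, Finset.sum_range_zero, h0]
  | succ N => simp [truncSum, Finset.sum_range_succ', h]

/-- `exp (ħ x)` in an algebra killed by `ħᴺ`. -/
def hexp (N : ℕ) (x : B) : B :=
  truncSum N fun k => (PowerSeries.C (1 / (k.factorial : ℚ)) : Qh) • x ^ k

theorem hexp_zero {N : ℕ} (hN : ∀ b : B, (hbar ^ N : Qh) • b = 0) : hexp N (0 : B) = 1 := by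
  rw [hexp, truncSum_single_zero hN]
  · simp
  · simp

theorem hexp_add {N : ℕ} (hN : ∀ b : B, (hbar ^ N : Qh) • b = 0) {x y : B} (h : Commute x y) :
    hexp N (x + y) = hexp N x * hexp N y := by
  rw [hexp, hexp, hexp, truncSum_mul hN]
  congr 1
  funext p
  rw [h.add_pow', Finset.smul_sum]
  refine Finset.sum_congr rfl fun k hk => ?_
  rw [Finset.HasAntidiagonal.mem_antidiagonal] at hk
  obtain ⟨a, b⟩ := k
  subst hk
  rw [smul_mul_smul_comm, ← map_mul, ← Nat.cast_smul_eq_nsmul Qh, smul_smul]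
  congr 1
  have h1 : (((a + b).choose a : ℕ) : Qh) = PowerSeries.C (((a + b).choose a : ℕ) : ℚ) := by
    simp
  rw [h1, ← map_mul, Nat.cast_add_choose ℚ]
  have ha : ((a + b).factorial : ℚ) ≠ 0 := by exact_mod_cast (a + b).factorial_ne_zero
  congr 1
  field_simp

theorem hexp_mul_of_semiconj {N : ℕ} {x x' y : B} (h : x * y = y * x') :
    hexp N x * y = y * hexp N x' := by
  refine truncSum_mul_comm_of fun k => ?_
  have hk : SemiconjBy y (x' ^ k) (x ^ k) := SemiconjBy.pow_right (show y * x' = x * y from h.symm) k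
  rw [smul_mul_assoc, mul_smul_comm, hk.eq]

theorem hexp_mul_hexp_neg {N : ℕ} (hN : ∀ b : B, (hbar ^ N : Qh) • b = 0) (x : B) :
    hexp N x * hexp N (-x) = 1 := by
  rw [← hexp_add hN (Commute.neg_right (Commute.refl x)), add_neg_cancel, hexp_zero hN]

theorem commute_hexp_right {N : ℕ} {x y : B} (h : Commute x y) : Commute x (hexp N y) :=
  (hexp_mul_of_semiconj h.eq.symm).symm

/-- `exp (tħ)` computed in the algebra agrees with the scalar `exp (tħ)`, because a scalar of
`ℚ[[ħ]]` acts through its truncation. -/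
theorem hexp_C_smul_one {N : ℕ} (hN : ∀ b : B, (hbar ^ N : Qh) • b = 0) (t : ℚ) :
    hexp N ((PowerSeries.C t : Qh) • (1 : B)) =
      (PowerSeries.rescale t (PowerSeries.exp ℚ) : Qh) • (1 : B) := by
  have hdvd : (PowerSeries.X ^ N : Qh) ∣ PowerSeries.rescale t (PowerSeries.exp ℚ) -
      ∑ k ∈ Finset.range N, PowerSeries.monomial k (t ^ k / (k.factorial : ℚ)) := by
    rw [PowerSeries.X_pow_dvd_iff]
    intro m hm
    rw [map_sub, map_sum, PowerSeries.coeff_rescale, PowerSeries.coeff_exp]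
    simp only [PowerSeries.coeff_monomial, Finset.sum_ite_eq, Finset.mem_range, hm, if_true]
    simp [div_eq_mul_inv]
  obtain ⟨g, hg⟩ := hdvd
  rw [sub_eq_iff_eq_add] at hg
  rw [hg, add_smul, mul_smul, hN, zero_add, hexp, truncSum, Finset.sum_smul]
  refine Finset.sum_congr rfl fun k _ => ?_
  rw [smul_pow, one_pow, smul_smul, smul_smul, ← map_pow, mul_assoc, ← map_mul,
    PowerSeries.monomial_eq_mk]
  congr 1
  ext m
  rw [PowerSeries.X_pow_mul, PowerSeries.coeff_C_mul_X_pow, PowerSeries.coeff_mk]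
  refine if_congr Iff.rfl ?_ rfl
  ring

/-- `∑ₙ ħⁿ rCoeff n Xⁿ`, that is `∑ₙ q^{n(n-1)/2} q^{-n/2} (q-1)ⁿ / [n]_q! Xⁿ`. -/
def qexp (N : ℕ) (X : B) : B := truncSum N fun n => rCoeff n • X ^ n

/-- `∑ₙ ħⁿ rInvCoeff n Xⁿ`, the inverse of `qexp N X`. -/
def qexpInv (N : ℕ) (X : B) : B := truncSum N fun n => rInvCoeff n • X ^ n

theorem qexp_mul_of_semiconj {N : ℕ} {x x' y : B} (h : x * y = y * x') :
    qexp N x * y = y * qexp N x' := by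
  refine truncSum_mul_comm_of fun k => ?_
  have hk : SemiconjBy y (x' ^ k) (x ^ k) := SemiconjBy.pow_right (show y * x' = x * y from h.symm) k
  rw [smul_mul_assoc, mul_smul_comm, hk.eq]

theorem commute_qexp_right {N : ℕ} {x y : B} (h : Commute x y) : Commute x (qexp N y) :=
  (qexp_mul_of_semiconj h.eq.symm).symm

end Truncated

/-! ### The `q`-exponential -/

section QExponential

variable {B : Type*} [Ring B] [Algebra Qh B]

theorem pow_mul_of_qCommute {x y : B} (h : x * y = q • (y * x)) (n : ℕ) :
    x ^ n * y = q ^ n • (y * x ^ n) := by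
  induction n with
  | zero => simp
  | succ n ih =>
    rw [pow_succ, mul_assoc, h, mul_smul_comm, ← mul_assoc, ih, smul_mul_assoc, smul_smul,
      mul_assoc, ← pow_succ']

/-- The `q`-binomial theorem, with the `q`-binomial coefficients absorbed into `rCoeff`. -/
theorem sum_antidiagonal_rCoeff {x y : B} (h : x * y = q • (y * x)) (p : ℕ) :
    ∑ k ∈ Finset.HasAntidiagonal.antidiagonal p,
      (rCoeff k.1 • x ^ k.1) * (rCoeff k.2 • y ^ k.2) = rCoeff p • (x + y) ^ p := by
  induction p with
  | zero => simp [rCoeff_zero]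
  | succ p ih =>
    refine (isUnit_qInt_succ p).smul_left_cancel.mp ?_
    rw [smul_smul, qInt_mul_rCoeff_succ, pow_succ', mul_smul, ← mul_smul_comm, ← ih,
      Finset.smul_sum]
    -- `[a + b] = [b] + q^b [a]`; each part lowers one of the two indices by the recursion.
    have hsplit : ∀ k ∈ Finset.HasAntidiagonal.antidiagonal (p + 1),
        qInt (p + 1) • ((rCoeff k.1 • x ^ k.1) * (rCoeff k.2 • y ^ k.2)) =
          ((q ^ k.2 * (qInt k.1 * rCoeff k.1)) • x ^ k.1) * (rCoeff k.2 • y ^ k.2) +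
          (rCoeff k.1 • x ^ k.1) * ((qInt k.2 * rCoeff k.2) • y ^ k.2) := by
      intro k hk
      rw [Finset.HasAntidiagonal.mem_antidiagonal] at hk
      rw [← hk, add_comm k.1, qInt_add]
      simp only [smul_mul_smul_comm, smul_smul, ← add_smul]
      congr 1
      ring
    rw [Finset.sum_congr rfl hsplit, Finset.sum_add_distrib, Finset.Nat.sum_antidiagonal_succ,
      Finset.Nat.sum_antidiagonal_succ', add_mul, smul_add, Finset.mul_sum, Finset.mul_sum,
      Finset.smul_sum, Finset.smul_sum]
    simp only [qInt_zero, zero_mul, mul_zero, zero_smul, zero_add]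
    congr 1
    · refine Finset.sum_congr rfl fun k hk => ?_
      rw [Finset.HasAntidiagonal.mem_antidiagonal] at hk
      rw [qInt_mul_rCoeff_succ, ← hk, pow_add q, pow_succ' x]
      simp only [mul_smul_comm, smul_mul_assoc, smul_smul, mul_assoc]
      congr 1
      ring
    · refine Finset.sum_congr rfl fun k hk => ?_
      rw [Finset.HasAntidiagonal.mem_antidiagonal] at hk
      rw [qInt_mul_rCoeff_succ, ← hk, pow_add q, pow_succ' y]
      simp only [mul_smul_comm, smul_mul_assoc, smul_smul, mul_assoc]
      rw [← mul_assoc (x ^ k.1), pow_mul_of_qCommute h, smul_mul_assoc, smul_smul, mul_assoc y]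
      congr 1
      ring

theorem qexp_add {N : ℕ} (hN : ∀ b : B, (hbar ^ N : Qh) • b = 0) {x y : B}
    (h : x * y = q • (y * x)) : qexp N (x + y) = qexp N x * qexp N y := by
  rw [qexp, qexp, qexp, truncSum_mul hN]
  congr 1
  funext p
  exact (sum_antidiagonal_rCoeff h p).symm

theorem sum_antidiagonal_rCoeff_rInvCoeff (p : ℕ) :
    ∑ k ∈ Finset.HasAntidiagonal.antidiagonal (p + 1), rCoeff k.1 * rInvCoeff k.2 = 0 := by
  refine (isUnit_qInt_succ p).mul_right_eq_zero.mp ?_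
  -- `[a + b] = [a] + q^a [b]`; after lowering the indices the two parts cancel.
  have hsplit : ∀ k ∈ Finset.HasAntidiagonal.antidiagonal (p + 1),
      qInt (p + 1) * (rCoeff k.1 * rInvCoeff k.2) =
        (qInt k.1 * rCoeff k.1) * rInvCoeff k.2 +
        q ^ k.1 * rCoeff k.1 * (qInt k.2 * rInvCoeff k.2) := by
    intro k hk
    rw [Finset.HasAntidiagonal.mem_antidiagonal] at hk
    rw [← hk, qInt_add]
    ring
  rw [Finset.mul_sum, Finset.sum_congr rfl hsplit, Finset.sum_add_distrib,
    Finset.Nat.sum_antidiagonal_succ, Finset.Nat.sum_antidiagonal_succ']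
  simp only [qInt_zero, zero_mul, mul_zero, zero_add, ← Finset.sum_add_distrib]
  refine Finset.sum_eq_zero fun k _ => ?_
  rw [qInt_mul_rCoeff_succ, qInt_mul_rInvCoeff_succ]
  ring

theorem qexp_mul_qexpInv {N : ℕ} (hN : ∀ b : B, (hbar ^ N : Qh) • b = 0) (x : B) :
    qexp N x * qexpInv N x = 1 := by
  have hterm : ∀ p, ∑ k ∈ Finset.HasAntidiagonal.antidiagonal p,
      (rCoeff k.1 • x ^ k.1) * (rInvCoeff k.2 • x ^ k.2) =
      (∑ k ∈ Finset.HasAntidiagonal.antidiagonal p, rCoeff k.1 * rInvCoeff k.2) • x ^ p := by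
    intro p
    rw [Finset.sum_smul]
    refine Finset.sum_congr rfl fun k hk => ?_
    rw [Finset.HasAntidiagonal.mem_antidiagonal] at hk
    rw [smul_mul_smul_comm, ← pow_add, hk]
  rw [qexp, qexpInv, truncSum_mul hN, truncSum_single_zero hN]
  · simp [rCoeff_zero, rInvCoeff_zero]
  · intro p
    rw [hterm, sum_antidiagonal_rCoeff_rInvCoeff, zero_smul]

theorem qexpInv_mul_qexp {N : ℕ} (hN : ∀ b : B, (hbar ^ N : Qh) • b = 0) (x : B) :
    qexpInv N x * qexp N x = 1 := by
  have hc : Commute x (qexp N x) := commute_qexp_right (Commute.refl x)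
  have hc' : Commute (qexpInv N x) (qexp N x) := by
    rw [qexpInv, truncSum]
    refine Commute.sum_left _ _ _ fun n _ => ?_
    exact ((hc.pow_left n).smul_left _).smul_left _
  rw [hc'.eq, qexp_mul_qexpInv hN]

end QExponential

/-! ### The Yang–Baxter equation in an algebra killed by a power of `ħ` -/

section RMatrix

variable {ι B : Type*} [Ring B] [Algebra Qh B]

/-- Pairwise commuting families `H i, E i, F i` satisfying the relations of `U_ħ(sl₂)` in an
algebra killed by `ħᴺ`.  The relation for `E F - F E` is multiplied by `q^{1/2} - q^{-1/2}`. -/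
structure QuantumTriples (N : ℕ) (H E F : ι → B) : Prop where
  smul_eq_zero : ∀ b : B, (hbar ^ N : Qh) • b = 0
  HE : ∀ i, H i * E i = E i * (H i + 2)
  HF : ∀ i, H i * F i = F i * (H i - 2)
  EF : ∀ i, (hbar * qDiff) • (E i * F i - F i * E i) =
    hexp N ((PowerSeries.C (1 / 2) : Qh) • H i) - hexp N (-((PowerSeries.C (1 / 2) : Qh) • H i))
  commHH : ∀ i j, Commute (H i) (H j)
  commHE : ∀ i j, i ≠ j → Commute (H i) (E j)
  commHF : ∀ i j, i ≠ j → Commute (H i) (F j)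
  commEE : ∀ i j, i ≠ j → Commute (E i) (E j)
  commFF : ∀ i j, i ≠ j → Commute (F i) (F j)
  commEF : ∀ i j, i ≠ j → Commute (E i) (F j)

/-- `K = exp (ħ H / 2)`. -/
def kElt (N : ℕ) (H : B) : B := hexp N ((PowerSeries.C (1 / 2) : Qh) • H)

/-- `K⁻¹ = exp (-ħ H / 2)`. -/
def kInv (N : ℕ) (H : B) : B := hexp N (-((PowerSeries.C (1 / 2) : Qh) • H))

/-- `D = exp (ħ/4 H ⊗ H')`. -/
def dElt (N : ℕ) (H H' : B) : B := hexp N ((PowerSeries.C (1 / 4) : Qh) • (H * H'))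

/-- The `R`-matrix, in an algebra killed by `ħᴺ`. -/
def rElt (N : ℕ) (H E F : ι → B) (i j : ι) : B := dElt N (H i) (H j) * qexp N (F i * E j)

/-- The coproduct of `F` in the tensorands `i` and `j`. -/
def deltaF (N : ℕ) (H F : ι → B) (i j : ι) : B := F i * kInv N (H j) + F j

variable {N : ℕ} {H E F : ι → B}

theorem C_half_smul_two : (PowerSeries.C (1 / 2) : Qh) • (2 : B) = (PowerSeries.C 1 : Qh) • 1 := by
  rw [show (2 : B) = (2 : Qh) • 1 by rw [Algebra.smul_def, map_ofNat, mul_one], smul_smul,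
    show (2 : Qh) = PowerSeries.C 2 from (map_ofNat PowerSeries.C 2).symm, ← map_mul]
  norm_num

theorem C_quarter_smul_mul_two (x : B) :
    (PowerSeries.C (1 / 4) : Qh) • (x * 2) = (PowerSeries.C (1 / 2) : Qh) • x := by
  rw [show (2 : B) = (2 : Qh) • 1 by rw [Algebra.smul_def, map_ofNat, mul_one], mul_smul_comm,
    smul_smul,
    show (2 : Qh) = PowerSeries.C 2 from (map_ofNat PowerSeries.C 2).symm, ← map_mul, mul_one]
  norm_num

theorem commute_dElt {N : ℕ} {x y z : B} (hy : Commute x y) (hz : Commute x z) :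
    Commute x (dElt N y z) :=
  commute_hexp_right ((hy.mul_right hz).smul_right _)

namespace QuantumTriples

variable (T : QuantumTriples N H E F)
include T

theorem hexp_one : hexp N ((PowerSeries.C (1 / 2) : Qh) • (2 : B)) = q • (1 : B) := by
  rw [C_half_smul_two, hexp_C_smul_one T.smul_eq_zero, PowerSeries.rescale_one, q,
    RingHom.id_apply]

theorem kElt_mul_kInv (i : ι) : kElt N (H i) * kInv N (H i) = 1 :=
  hexp_mul_hexp_neg T.smul_eq_zero _

theorem kInv_mul_kElt (i : ι) : kInv N (H i) * kElt N (H i) = 1 := by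
  have := hexp_mul_hexp_neg T.smul_eq_zero (-((PowerSeries.C (1 / 2) : Qh) • H i))
  rwa [neg_neg] at this

theorem kElt_mul_E (i : ι) : kElt N (H i) * E i = q • (E i * kElt N (H i)) := by
  have h : ((PowerSeries.C (1 / 2) : Qh) • H i) * E i =
      E i * ((PowerSeries.C (1 / 2) : Qh) • H i + (PowerSeries.C (1 / 2) : Qh) • 2) := by
    rw [← smul_add, smul_mul_assoc, mul_smul_comm, T.HE]
  rw [kElt, hexp_mul_of_semiconj h, hexp_add T.smul_eq_zero, T.hexp_one, mul_smul_comm, mul_one,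
    mul_smul_comm]
  exact (Commute.ofNat_right _ 2).smul_left _ |>.smul_right _

theorem E_mul_kInv (i : ι) : E i * kInv N (H i) = q • (kInv N (H i) * E i) := by
  have h := congrArg (fun z => kInv N (H i) * z * kInv N (H i)) (T.kElt_mul_E i)
  rw [← mul_assoc, T.kInv_mul_kElt, one_mul, mul_smul_comm, smul_mul_assoc, ← mul_assoc,
    mul_assoc _ (kElt N (H i)), T.kElt_mul_kInv, mul_one] at h
  exact h

theorem kInv_mul_F (i : ι) : kInv N (H i) * F i = q • (F i * kInv N (H i)) := by
  have h : (-((PowerSeries.C (1 / 2) : Qh) • H i)) * F i =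
      F i * (-((PowerSeries.C (1 / 2) : Qh) • H i) + (PowerSeries.C (1 / 2) : Qh) • 2) := by
    rw [← smul_neg, ← smul_add, smul_mul_assoc, mul_smul_comm, neg_mul, T.HF]
    congr 1
    noncomm_ring
  rw [kInv, hexp_mul_of_semiconj h, hexp_add T.smul_eq_zero, T.hexp_one, mul_smul_comm, mul_one,
    mul_smul_comm]
  exact ((Commute.ofNat_right _ 2).smul_left _ |>.smul_right _).neg_left

/-- The commutator `[Eⁿ⁺¹, F]`. -/
theorem commutator_E_pow (i : ι) (n : ℕ) :
    (q ^ n * (hbar * qDiff)) • (E i ^ (n + 1) * F i - F i * E i ^ (n + 1)) =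
      qInt (n + 1) • (kElt N (H i) * E i ^ n - E i ^ n * kInv N (H i)) := by
  induction n with
  | zero =>
    simpa [qInt, kElt, kInv] using T.EF i
  | succ n ih =>
    have h1 : E i ^ (n + 1 + 1) * F i - F i * E i ^ (n + 1 + 1) =
        E i * (E i ^ (n + 1) * F i - F i * E i ^ (n + 1)) +
          (E i * F i - F i * E i) * E i ^ (n + 1) := by
      rw [pow_succ' (E i) (n + 1)]
      noncomm_ring
    have h2 : (q ^ (n + 1) * (hbar * qDiff)) • (E i ^ (n + 1 + 1) * F i - F i * E i ^ (n + 1 + 1)) =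
        q • (E i * ((q ^ n * (hbar * qDiff)) • (E i ^ (n + 1) * F i - F i * E i ^ (n + 1)))) +
        q ^ (n + 1) • (((hbar * qDiff) • (E i * F i - F i * E i)) * E i ^ (n + 1)) := by
      rw [h1, smul_add]
      simp only [mul_smul_comm, smul_mul_assoc, smul_smul]
      congr 2
      ring
    have h3 : q ^ (n + 1) • (kInv N (H i) * E i ^ (n + 1)) = E i ^ (n + 1) * kInv N (H i) := by
      rw [pow_mul_of_qCommute (T.E_mul_kInv i)]
    have h4 : q • (E i * (kElt N (H i) * E i ^ n)) = kElt N (H i) * E i ^ (n + 1) := by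
      rw [← mul_assoc, ← smul_mul_assoc, ← T.kElt_mul_E, mul_assoc, ← pow_succ']
    have h5 : qInt (n + 1 + 1) = qInt (n + 1) + q ^ (n + 1) := by
      rw [qInt_add]; simp [qInt]
    have h6 : qInt (n + 1 + 1) = 1 + q * qInt (n + 1) := by
      rw [add_comm (n + 1) 1, qInt_add]; simp [qInt]
    rw [h2, ih, T.EF, ← kElt, ← kInv, sub_mul, smul_sub (q ^ (n + 1)), h3, mul_smul_comm,
      smul_comm q, mul_sub, smul_sub q, h4, ← mul_assoc (E i) (E i ^ n), ← pow_succ',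
      smul_sub (qInt (n + 1)), smul_smul, mul_comm _ q, smul_sub]
    nth_rewrite 1 [h5]
    rw [h6, add_smul, add_smul, one_smul]
    abel

/-- The commutator formula in the form in which it enters `R`: no division by `ħ` or by
`q^{1/2} - q^{-1/2}` is needed, only by the unit `[n+1]_q`. -/
theorem rCoeff_smul_commutator (i : ι) (n : ℕ) :
    (hbar ^ (n + 1) * rCoeff (n + 1)) • (E i ^ (n + 1) * F i - F i * E i ^ (n + 1)) =
      (hbar ^ n * rCoeff n) • (kElt N (H i) * E i ^ n - E i ^ n * kInv N (H i)) := by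
  refine (isUnit_qInt_succ n).smul_left_cancel.mp ?_
  rw [smul_comm _ (hbar ^ n * rCoeff n), ← T.commutator_E_pow, smul_smul, smul_smul]
  congr 1
  linear_combination hbar ^ (n + 1) * qInt_mul_rCoeff_succ n

theorem commute_F_kElt {i j : ι} (h : i ≠ j) : Commute (F i) (kElt N (H j)) :=
  commute_hexp_right ((T.commHF j i h.symm).symm.smul_right _)

theorem commute_E_kInv {i j : ι} (h : i ≠ j) : Commute (E i) (kInv N (H j)) :=
  commute_hexp_right ((T.commHE j i h.symm).symm.smul_right _).neg_right

theorem commute_kElt_H (i j : ι) : Commute (kElt N (H i)) (H j) :=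
  (commute_hexp_right ((T.commHH j i).smul_right _)).symm

theorem commute_dElt_dElt (i j k m : ι) :
    Commute (dElt N (H i) (H j)) (dElt N (H k) (H m)) :=
  commute_dElt (commute_dElt (T.commHH k i) (T.commHH k j)).symm
    (commute_dElt (T.commHH m i) (T.commHH m j)).symm

theorem dElt_comm (i j : ι) : dElt N (H i) (H j) = dElt N (H j) (H i) := by
  rw [dElt, dElt, (T.commHH i j).eq]

/-- Conjugation by `D` multiplies `F ⊗ 1` by `1 ⊗ K⁻¹`. -/
theorem dElt_mul_F {i j : ι} (h : i ≠ j) :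
    dElt N (H i) (H j) * F i = F i * kInv N (H j) * dElt N (H i) (H j) := by
  have hs : ((PowerSeries.C (1 / 4) : Qh) • (H i * H j)) * F i =
      F i * (-((PowerSeries.C (1 / 2) : Qh) • H j) +
        (PowerSeries.C (1 / 4) : Qh) • (H i * H j)) := by
    rw [← C_quarter_smul_mul_two, ← smul_neg, ← smul_add, smul_mul_assoc, mul_smul_comm, mul_assoc,
      (T.commHF j i h.symm).eq, ← mul_assoc, T.HF]
    congr 1
    noncomm_ring
  rw [dElt, hexp_mul_of_semiconj hs, hexp_add T.smul_eq_zero, kInv, mul_assoc]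
  exact (((T.commHH j i).mul_right (T.commHH j j)).smul_left _ |>.smul_right _).neg_left

theorem E_mul_dElt {j k : ι} (h : j ≠ k) :
    E k * dElt N (H j) (H k) = dElt N (H j) (H k) * (kInv N (H j) * E k) := by
  have hs : ((PowerSeries.C (1 / 4) : Qh) • (H j * H k) +
      -((PowerSeries.C (1 / 2) : Qh) • H j)) * E k =
      E k * ((PowerSeries.C (1 / 4) : Qh) • (H j * H k)) := by
    rw [← C_quarter_smul_mul_two, ← smul_neg, ← smul_add, smul_mul_assoc, mul_smul_comm, add_mul,
      mul_assoc, T.HE, ← mul_assoc, (T.commHE j k h).eq]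
    congr 1
    rw [neg_mul, mul_assoc (H j), ← (Commute.ofNat_right (E k) 2).eq, ← mul_assoc,
      (T.commHE j k h).eq]
    noncomm_ring
  rw [dElt, ← hexp_mul_of_semiconj hs, hexp_add T.smul_eq_zero, kInv, mul_assoc]
  exact (((T.commHH j j).mul_left (T.commHH k j)).smul_left _ |>.smul_right _).neg_right

/-- `(Δ ⊗ 1)(R) = R₁₃ R₂₃`. -/
theorem rElt_mul_rElt {i j k : ι} (hij : i ≠ j) (hik : i ≠ k) (hjk : j ≠ k) :
    rElt N H E F i k * rElt N H E F j k =
      dElt N (H i) (H k) * dElt N (H j) (H k) * qexp N (deltaF N H F i j * E k) := by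
  have h1 : F i * E k * dElt N (H j) (H k) =
      dElt N (H j) (H k) * (F i * kInv N (H j) * E k) := by
    rw [mul_assoc, T.E_mul_dElt hjk, ← mul_assoc,
      (commute_dElt (T.commHF j i hij.symm).symm (T.commHF k i hik.symm).symm).eq,
      mul_assoc, mul_assoc]
  have h2 : (F i * kInv N (H j) * E k) * (F j * E k) =
      q • ((F j * E k) * (F i * kInv N (H j) * E k)) := by
    have e1 : (F i * kInv N (H j) * E k) * (F j * E k) =
        F i * (kInv N (H j) * F j) * (E k * E k) := by
      simp only [mul_assoc]
      rw [← mul_assoc (E k) (F j), (T.commEF k j hjk.symm).eq, mul_assoc (F j)]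
    have e2 : (F j * E k) * (F i * kInv N (H j) * E k) =
        F i * (F j * kInv N (H j)) * (E k * E k) := by
      have e3 : Commute (F j * E k) (F i) :=
        (T.commFF j i hij.symm).mul_left (T.commEF k i hik.symm)
      rw [mul_assoc (F i), ← mul_assoc, e3.eq, mul_assoc, mul_assoc (F i), mul_assoc (F j),
        ← mul_assoc (E k), (T.commute_E_kInv hjk.symm).eq]
      simp only [mul_assoc]
    rw [e1, e2, T.kInv_mul_F, mul_smul_comm, smul_mul_assoc]
  rw [rElt, rElt, deltaF, add_mul, qexp_add T.smul_eq_zero h2, mul_assoc,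
    ← mul_assoc (qexp N (F i * E k)), qexp_mul_of_semiconj h1]
  simp only [mul_assoc]

/-- The part of `R Δ(F) = Δᵒᵖ(F) R` that remains after conjugation by `D`. -/
theorem qexp_mul_deltaF {i j : ι} (h : i ≠ j) :
    qexp N (F i * E j) * deltaF N H F i j =
      (F j + F i * kElt N (H j)) * qexp N (F i * E j) := by
  have hpow : ∀ n, (F i * E j) ^ n = F i ^ n * E j ^ n := fun n =>
    (T.commEF j i h.symm).symm.mul_pow n
  have hcomm : ∀ n, (F i * E j) ^ n * F j - F j * (F i * E j) ^ n =
      F i ^ n * (E j ^ n * F j - F j * E j ^ n) := fun n => by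
    rw [hpow, mul_sub, ← mul_assoc, ← mul_assoc, ← mul_assoc,
      ((T.commFF i j h).pow_left n).eq]
  have hG : ∀ n, F i * kElt N (H j) * (F i * E j) ^ n - (F i * E j) ^ n * (F i * kInv N (H j)) =
      F i ^ (n + 1) * (kElt N (H j) * E j ^ n - E j ^ n * kInv N (H j)) := fun n => by
    rw [hpow, mul_sub]
    congr 1
    · rw [mul_assoc, ← mul_assoc (kElt N (H j)),
        ← ((T.commute_F_kElt h).pow_left n).eq, pow_succ']
      simp only [mul_assoc]
    · rw [mul_assoc, ← mul_assoc (E j ^ n), ((T.commEF j i h.symm).pow_left n).eq, pow_succ]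
      simp only [mul_assoc]
  have key : ∑ n ∈ Finset.range N, (hbar ^ n * rCoeff n) •
        (F i ^ n * (E j ^ n * F j - F j * E j ^ n)) =
      ∑ n ∈ Finset.range N, (hbar ^ n * rCoeff n) •
        (F i ^ (n + 1) * (kElt N (H j) * E j ^ n - E j ^ n * kInv N (H j))) := by
    -- The two sums are shifted against each other by one; the surplus term carries `ħᴺ = 0`.
    have hlast : (hbar ^ N * rCoeff N) • (F i ^ N * (E j ^ N * F j - F j * E j ^ N)) = 0 := by
      rw [mul_smul, T.smul_eq_zero]
    rw [← add_zero (∑ n ∈ Finset.range N, (hbar ^ n * rCoeff n) •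
      (F i ^ n * (E j ^ n * F j - F j * E j ^ n))), ← hlast, ← Finset.sum_range_succ,
      Finset.sum_range_succ']
    simp only [pow_zero, one_mul, mul_one, sub_self, mul_zero, smul_zero, add_zero]
    refine Finset.sum_congr rfl fun n _ => ?_
    rw [← mul_smul_comm, T.rCoeff_smul_commutator, mul_smul_comm]
  have hsum : ∀ x y : B, ∀ u : ℕ → B, truncSum N (fun n => rCoeff n • u n) * x -
      y * truncSum N (fun n => rCoeff n • u n) =
      ∑ n ∈ Finset.range N, (hbar ^ n * rCoeff n) • (u n * x - y * u n) := fun x y u => by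
    rw [truncSum, Finset.sum_mul, Finset.mul_sum, ← Finset.sum_sub_distrib]
    refine Finset.sum_congr rfl fun n _ => ?_
    rw [smul_smul, smul_mul_assoc, mul_smul_comm, smul_sub]
  have hA := hsum (F j) (F j) (fun n => (F i * E j) ^ n)
  have hB := hsum (-(F i * kInv N (H j))) (-(F i * kElt N (H j))) (fun n => (F i * E j) ^ n)
  simp only [hcomm] at hA
  simp only [mul_neg, neg_mul, neg_sub_neg, hG] at hB
  rw [key, ← hB] at hA
  rw [deltaF, mul_add, add_mul, qexp]
  rw [← sub_eq_zero] at hA ⊢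
  rw [← hA]
  abel

/-- `R Δ(F) = Δᵒᵖ(F) R`. -/
theorem rElt_mul_deltaF {i j : ι} (h : i ≠ j) :
    rElt N H E F i j * deltaF N H F i j = deltaF N H F j i * rElt N H E F i j := by
  have h1 : dElt N (H i) (H j) * F j = F j * kInv N (H i) * dElt N (H i) (H j) := by
    rw [T.dElt_comm, T.dElt_mul_F h.symm]
  have h2 : dElt N (H i) (H j) * (F i * kElt N (H j)) = F i * dElt N (H i) (H j) := by
    rw [← mul_assoc, T.dElt_mul_F h, mul_assoc,
      ← (commute_dElt (T.commute_kElt_H j i) (T.commute_kElt_H j j)).eq, ← mul_assoc,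
      mul_assoc (F i), T.kInv_mul_kElt, mul_one]
  rw [rElt, mul_assoc, T.qexp_mul_deltaF h, ← mul_assoc, mul_add, h1, h2, ← add_mul, mul_assoc,
    deltaF]

theorem commute_rElt_dElt_mul_dElt {i j k : ι} (hij : i ≠ j) (hik : i ≠ k) (hjk : j ≠ k) :
    Commute (rElt N H E F i j) (dElt N (H i) (H k) * dElt N (H j) (H k)) := by
  have hc : Commute ((PowerSeries.C (1 / 4) : Qh) • (H i * H k))
      ((PowerSeries.C (1 / 4) : Qh) • (H j * H k)) :=
    ((((T.commHH i j).mul_left (T.commHH k j)).mul_right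
      ((T.commHH i k).mul_left (T.commHH k k))).smul_left _).smul_right _
  refine Commute.mul_left ((T.commute_dElt_dElt i j i k).mul_right
    (T.commute_dElt_dElt i j j k)) ?_
  rw [dElt, dElt, ← hexp_add T.smul_eq_zero hc, ← smul_add, ← add_mul]
  refine commute_hexp_right (Commute.smul_right (Commute.mul_right ?_ ?_) _)
  · refine (commute_qexp_right ?_).symm
    have e1 : H i * (F i * E j) = F i * E j * H i - 2 * (F i * E j) := by
      rw [← mul_assoc, T.HF, mul_sub, sub_mul, mul_assoc, (T.commHE i j hij).eq,
        (Commute.ofNat_right (F i) 2).eq]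
      simp only [mul_assoc]
    have e2 : H j * (F i * E j) = F i * E j * H j + 2 * (F i * E j) := by
      rw [← mul_assoc, (T.commHF j i hij.symm).eq, mul_assoc, T.HE, mul_add,  mul_add,
        (Commute.ofNat_right (E j) 2).eq, ← mul_assoc (F i) 2, (Commute.ofNat_right (F i) 2).eq]
      simp only [mul_assoc]
    rw [commute_iff_eq, add_mul, e1, e2, mul_add]
    abel
  · exact (commute_qexp_right
      ((T.commHF k i hik.symm).mul_right (T.commHE k j hjk.symm))).symm

/-- The Yang–Baxter equation: `R₁₂ (Δ ⊗ 1)(R) = (Δᵒᵖ ⊗ 1)(R) R₁₂`, in which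
`(Δᵒᵖ ⊗ 1)(R) = R₂₃ R₁₃` is `(Δ ⊗ 1)(R) = R₁₃ R₂₃` with the first two tensorands exchanged. -/
theorem yangBaxter {i j k : ι} (hij : i ≠ j) (hik : i ≠ k) (hjk : j ≠ k) :
    rElt N H E F i j * (rElt N H E F i k * rElt N H E F j k) =
      rElt N H E F j k * (rElt N H E F i k * rElt N H E F i j) := by
  have hsemi : deltaF N H F j i * E k * rElt N H E F i j =
      rElt N H E F i j * (deltaF N H F i j * E k) := by
    have hE : Commute (E k) (rElt N H E F i j) := by
      refine Commute.mul_right ?_ (commute_qexp_right ?_)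
      · exact commute_dElt (T.commHE i k hik).symm (T.commHE j k hjk).symm
      · exact (T.commEF k i hik.symm).mul_right (T.commEE k j hjk.symm)
    rw [mul_assoc, hE.eq, ← mul_assoc, ← T.rElt_mul_deltaF hij, mul_assoc]
  rw [T.rElt_mul_rElt hij hik hjk, ← mul_assoc, (T.commute_rElt_dElt_mul_dElt hij hik hjk).eq,
    mul_assoc, ← qexp_mul_of_semiconj hsemi, ← mul_assoc, ← mul_assoc (rElt N H E F j k),
    T.rElt_mul_rElt hij.symm hjk hik, (T.commute_dElt_dElt j k i k).eq]

/-- `R`-matrices on disjoint pairs of tensorands commute. -/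
theorem commute_rElt_rElt {i j k m : ι} (hik : i ≠ k) (him : i ≠ m) (hjk : j ≠ k) (hjm : j ≠ m) :
    Commute (rElt N H E F i j) (rElt N H E F k m) := by
  have hF : Commute (F i) (rElt N H E F k m) :=
    (commute_dElt (T.commHF k i hik.symm).symm (T.commHF m i him.symm).symm).mul_right
      (commute_qexp_right ((T.commFF i k hik).mul_right (T.commEF m i him.symm).symm))
  have hE : Commute (E j) (rElt N H E F k m) :=
    (commute_dElt (T.commHE k j hjk.symm).symm (T.commHE m j hjm.symm).symm).mul_right
      (commute_qexp_right ((T.commEF j k hjk).mul_right (T.commEE j m hjm)))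
  have hH : ∀ a, a ≠ k → a ≠ m → Commute (H a) (rElt N H E F k m) := fun a hk hm =>
    (commute_dElt (T.commHH a k) (T.commHH a m)).mul_right
      (commute_qexp_right ((T.commHF a k hk).mul_right (T.commHE a m hm)))
  refine Commute.mul_left ?_ (commute_qexp_right (hF.mul_left hE).symm).symm
  exact (commute_dElt (hH i hik him).symm (hH j hjk hjm).symm).symm

theorem rElt_mul_inv (i j : ι) :
    rElt N H E F i j * (qexpInv N (F i * E j) *
      hexp N (-((PowerSeries.C (1 / 4) : Qh) • (H i * H j)))) = 1 := by
  rw [rElt, mul_assoc, ← mul_assoc (qexp N _), qexp_mul_qexpInv T.smul_eq_zero, one_mul, dElt,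
    hexp_mul_hexp_neg T.smul_eq_zero]

theorem inv_mul_rElt (i j : ι) :
    (qexpInv N (F i * E j) *
      hexp N (-((PowerSeries.C (1 / 4) : Qh) • (H i * H j)))) * rElt N H E F i j = 1 := by
  have h := hexp_mul_hexp_neg T.smul_eq_zero (-((PowerSeries.C (1 / 4) : Qh) • (H i * H j)))
  rw [neg_neg] at h
  rw [rElt, mul_assoc, ← mul_assoc (hexp N _), dElt, h, one_mul, qexpInv_mul_qexp T.smul_eq_zero]

end QuantumTriples

end RMatrix

/-! ### The quotients of an `ħ`-adic completion -/

section Levels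

variable {A : Type} [Ring A] [Algebra Qh A]

variable (A) in
/-- The projection from the `ħ`-adic completion of `A` to `A / ħⁿ A`. -/
def level (n : ℕ) : HCompletion A →ₐ[Qh] A ⧸ hIdeal A n where
  toFun x := x.1 n
  map_one' := rfl
  map_mul' _ _ := rfl
  map_zero' := rfl
  map_add' _ _ := rfl
  commutes' _ := rfl

theorem ext_level {x y : HCompletion A} (h : ∀ n, level A n x = level A n y) : x = y :=
  Subtype.ext (funext h)

theorem level_killed (n : ℕ) (b : A ⧸ hIdeal A n) : (hbar ^ n : Qh) • b = 0 := by
  obtain ⟨a, rfl⟩ := Ideal.Quotient.mk_surjective b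
  rw [Algebra.smul_def]
  change Ideal.Quotient.mk _ (algebraMap Qh A (hbar ^ n) * a) = 0
  rw [Ideal.Quotient.eq_zero_iff_mem, Algebra.commutes]
  exact Ideal.mul_mem_left _ _ (Ideal.mem_span_singleton_self _)

theorem level_hSum (n : ℕ) (a : ℕ → A) :
    level A n (hSum a) = truncSum n fun k => level A n (toCompletion A (a k)) := by
  change Ideal.Quotient.mk _ (∑ k ∈ Finset.range n, (hbar ^ k : Qh) • a k) = _
  rw [map_sum]
  refine Finset.sum_congr rfl fun k _ => ?_
  rw [← map_smul, ← map_smul]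
  rfl

/-- A convergent series is its `N`th partial sum plus `ħᴺ` times a convergent series. -/
theorem hSum_eq_add (N : ℕ) (a : ℕ → A) :
    hSum a = ∑ k ∈ Finset.range N, (hbar ^ k : Qh) • toCompletion A (a k) +
      (hbar ^ N : Qh) • hSum fun k => a (N + k) := by
  refine ext_level fun n => ?_
  rw [map_add, map_sum, map_smul, level_hSum, level_hSum]
  have h1 : ∀ M, (∑ k ∈ Finset.range (n + M), (hbar ^ k : Qh) • level A n (toCompletion A (a k))) =
      ∑ k ∈ Finset.range n, (hbar ^ k : Qh) • level A n (toCompletion A (a k)) := fun M => by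
    rw [Finset.sum_range_add, add_eq_left]
    refine Finset.sum_eq_zero fun k _ => ?_
    rw [pow_add, mul_smul, level_killed]
  rw [truncSum, truncSum, ← h1 N, add_comm n N, Finset.sum_range_add, Finset.smul_sum]
  simp only [map_smul, pow_add, mul_smul]

/-- A homomorphism to an algebra killed by `ħᴺ` evaluates series termwise; no continuity
assumption is needed. -/
theorem map_hSum {B : Type*} [Ring B] [Algebra Qh B] {N : ℕ}
    (hN : ∀ b : B, (hbar ^ N : Qh) • b = 0) (φ : HCompletion A →ₐ[Qh] B) (a : ℕ → A) :
    φ (hSum a) = truncSum N fun k => φ (toCompletion A (a k)) := by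
  rw [hSum_eq_add N, map_add, map_smul, hN, add_zero, map_sum, truncSum]
  simp only [map_smul]

end Levels

/-! ### The relations of the quantized enveloping algebra -/

section Relations

theorem Uh.gen_HE : Uh.gen .H * Uh.gen .E - Uh.gen .E * Uh.gen .H = 2 * Uh.gen .E := by
  have h := congrArg (toCompletion _) (RingQuot.mkAlgHom_rel Qh UhRel.HE)
  simp only [map_sub, map_mul, map_ofNat] at h
  exact h

theorem Uh.gen_HF : Uh.gen .H * Uh.gen .F - Uh.gen .F * Uh.gen .H = -(2 * Uh.gen .F) := by
  have h := congrArg (toCompletion _) (RingQuot.mkAlgHom_rel Qh UhRel.HF)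
  simp only [map_sub, map_mul, map_ofNat, map_neg] at h
  exact h

theorem Uh.gen_EF : Uh.gen .E * Uh.gen .F - Uh.gen .F * Uh.gen .E =
    toCompletion _ (RingQuot.mkAlgHom Qh UhRel FreeHat.commEF) := by
  have h := congrArg (toCompletion _) (RingQuot.mkAlgHom_rel Qh UhRel.EF)
  simp only [map_sub, map_mul] at h
  exact h

theorem qDiff_mul_inv : qDiff * qDiff⁻¹ = 1 := by
  refine PowerSeries.mul_inv_cancel _ ?_
  simp [qDiff, sinhCoeff]
  norm_num

theorem sinhCoeff_zero : sinhCoeff 0 = 0 := by simp [sinhCoeff]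

variable {B : Type*} [Ring B] [Algebra Qh B] {N : ℕ}

theorem map_gen_EF (hN : ∀ b : B, (hbar ^ N : Qh) • b = 0) (φ : Uh →ₐ[Qh] B) :
    φ (Uh.gen .E) * φ (Uh.gen .F) - φ (Uh.gen .F) * φ (Uh.gen .E) =
      qDiff⁻¹ • truncSum N fun k =>
        (PowerSeries.C (sinhCoeff (k + 1)) : Qh) • φ (Uh.gen .H) ^ (k + 1) := by
  have h := congrArg φ Uh.gen_EF
  rw [map_sub, map_mul, map_mul] at h
  rw [h, FreeHat.commEF]
  have h2 := map_hSum hN ((φ.comp (toCompletion _)).comp (RingQuot.mkAlgHom Qh UhRel))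
    (fun k => (PowerSeries.C (sinhCoeff (k + 1)) : Qh) • (FreeAlgebra.ι Qh Gen.H) ^ (k + 1))
  simp only [AlgHom.comp_apply] at h2
  rw [map_smul, map_smul, map_smul, h2]
  simp only [map_smul, map_pow]
  rfl

/-- The relation for `E F - F E`, cleared of its denominator `q^{1/2} - q^{-1/2}`. -/
theorem smul_map_gen_EF (hN : ∀ b : B, (hbar ^ N : Qh) • b = 0) (φ : Uh →ₐ[Qh] B) :
    (hbar * qDiff) • (φ (Uh.gen .E) * φ (Uh.gen .F) - φ (Uh.gen .F) * φ (Uh.gen .E)) =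
      hexp N ((PowerSeries.C (1 / 2) : Qh) • φ (Uh.gen .H)) -
        hexp N (-((PowerSeries.C (1 / 2) : Qh) • φ (Uh.gen .H))) := by
  set H := φ (Uh.gen .H)
  have hsinh : hexp N ((PowerSeries.C (1 / 2) : Qh) • H) -
      hexp N (-((PowerSeries.C (1 / 2) : Qh) • H)) =
      ∑ k ∈ Finset.range N, (hbar ^ k : Qh) • (PowerSeries.C (sinhCoeff k) : Qh) • H ^ k := by
    rw [hexp, hexp, truncSum, truncSum, ← Finset.sum_sub_distrib]
    refine Finset.sum_congr rfl fun k _ => ?_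
    rw [← smul_sub, ← neg_smul, ← map_neg, smul_pow, smul_pow, smul_smul, smul_smul, ← sub_smul,
      ← map_pow, ← map_pow, ← map_mul, ← map_mul, ← map_sub, sinhCoeff]
    congr 3
    ring
  rw [map_gen_EF hN, smul_smul, mul_assoc, qDiff_mul_inv, mul_one, hsinh,
    ← add_zero (∑ k ∈ Finset.range N, _), ← hN ((PowerSeries.C (sinhCoeff N) : Qh) • H ^ N),
    ← Finset.sum_range_succ (fun k => (hbar ^ k : Qh) • (PowerSeries.C (sinhCoeff k) : Qh) • H ^ k),
    Finset.sum_range_succ', sinhCoeff_zero, map_zero, zero_smul, smul_zero, add_zero, truncSum,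
    Finset.smul_sum]
  refine Finset.sum_congr rfl fun k _ => ?_
  rw [smul_smul, pow_succ' hbar]

/-- `[E, F] ≡ H` modulo `ħ`. -/
theorem Uh.exists_EF_eq : ∃ z : Uh, Uh.gen .E * Uh.gen .F - Uh.gen .F * Uh.gen .E =
    Uh.gen .H + (hbar : Qh) • z := by
  obtain ⟨g, hg⟩ : (PowerSeries.X : Qh) ∣ qDiff⁻¹ - 1 := by
    rw [PowerSeries.X_dvd_iff, map_sub, map_one, PowerSeries.constantCoeff_inv, qDiff,
      PowerSeries.constantCoeff_mk, sinhCoeff]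
    norm_num
  rw [sub_eq_iff_eq_add] at hg
  have hs : sinhCoeff (0 + 1) = 1 := by norm_num [sinhCoeff]
  obtain ⟨y, hy⟩ : ∃ y : FreeHat, FreeHat.commEF = FreeHat.gen .H + (hbar : Qh) • y := by
    rw [FreeHat.commEF, hSum_eq_add 1, Finset.sum_range_one, hs, pow_zero, one_smul, pow_one,
      map_one, one_smul, pow_one, ← FreeHat.gen, hg, add_smul, one_smul, mul_smul]
    exact ⟨_, by rw [add_left_comm, ← smul_add]⟩
  rw [Uh.gen_EF, hy, map_add, map_smul, map_add, map_smul]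
  exact ⟨_, rfl⟩

end Relations

/-! ### The `R`-matrix in the completed tensor power -/

section RMatrixHat

variable (l : ℕ)

theorem commute_inTensor {i j : Fin l} (h : i ≠ j) (x y : Uh) :
    Commute (inTensor l i x) (inTensor l j y) :=
  Commute.tprod (Pi.mulSingle_commute (f := fun _ : Fin l => Uh) h x y)

theorem commute_inHat {i j : Fin l} (h : i ≠ j) (x y : Uh) :
    Commute (inHat l i x) (inHat l j y) :=
  (commute_inTensor l h x y).map (toCompletion (UhTensor l))

/-- The image of a generator in the `i`th tensorand, modulo `ħⁿ`. -/
def levelGen (n : ℕ) (x : Gen) (i : Fin l) : UhTensor l ⧸ hIdeal (UhTensor l) n :=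
  level (UhTensor l) n (inHat l i (Uh.gen x))

theorem quantumTriples_level (n : ℕ) :
    QuantumTriples n (levelGen l n .H) (levelGen l n .E) (levelGen l n .F) := by
  have hc : ∀ (x y : Gen) (i j : Fin l), i ≠ j → Commute (levelGen l n x i) (levelGen l n y j) :=
    fun x y i j h => (commute_inHat l h _ _).map (level (UhTensor l) n)
  refine ⟨level_killed n, fun i => ?_, fun i => ?_, fun i => ?_, fun i j => ?_, hc _ _, hc _ _,
    hc _ _, hc _ _, hc _ _⟩
  · have h := congrArg ((level (UhTensor l) n).comp (inHat l i)) Uh.gen_HE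
    simp only [map_sub, map_mul, map_ofNat, AlgHom.comp_apply] at h
    change levelGen l n .H i * levelGen l n .E i - levelGen l n .E i * levelGen l n .H i =
      2 * levelGen l n .E i at h
    rw [mul_add, (Commute.ofNat_right (levelGen l n .E i) 2).eq, ← h]
    abel
  · have h := congrArg ((level (UhTensor l) n).comp (inHat l i)) Uh.gen_HF
    simp only [map_sub, map_mul, map_ofNat, AlgHom.comp_apply, map_neg] at h
    change levelGen l n .H i * levelGen l n .F i - levelGen l n .F i * levelGen l n .H i =
      -(2 * levelGen l n .F i) at h
    rw [mul_sub, (Commute.ofNat_right (levelGen l n .F i) 2).eq, sub_eq_add_neg, ← h]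
    abel
  · exact smul_map_gen_EF (level_killed n) ((level (UhTensor l) n).comp (inHat l i))
  · by_cases h : i = j
    · rw [h]
    · exact hc _ _ _ _ h

theorem level_expHH (n : ℕ) (t : ℚ) {i j : Fin l} (hij : i ≠ j) :
    level (UhTensor l) n (expHH l t i j) =
      hexp n ((PowerSeries.C t : Qh) • (levelGen l n .H i * levelGen l n .H j)) := by
  rw [expHH, level_hSum, hexp]
  congr 1
  funext k
  rw [map_smul, map_smul, ← (commute_inTensor l hij _ _).mul_pow, map_pow, map_pow, smul_pow,
    smul_smul, ← map_pow PowerSeries.C, ← map_mul PowerSeries.C, map_mul (toCompletion _),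
    map_mul (level _ n), one_div_mul_eq_div]
  rfl

theorem level_qseries (n : ℕ) (c : ℕ → Qh) {i j : Fin l} (hij : i ≠ j) :
    level (UhTensor l) n (hSum fun k => c k •
      ((inTensor l i (Uh.gen .F)) ^ k * (inTensor l j (Uh.gen .E)) ^ k)) =
      truncSum n fun k => c k • (levelGen l n .F i * levelGen l n .E j) ^ k := by
  rw [level_hSum]
  congr 1
  funext k
  rw [map_smul, map_smul, ← (commute_inTensor l hij _ _).mul_pow, map_pow, map_pow,
    map_mul (toCompletion _), map_mul (level _ n)]
  rfl

theorem level_rMatrix (n : ℕ) {i j : Fin l} (hij : i ≠ j) :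
    level (UhTensor l) n (rMatrix l i j) =
      rElt n (levelGen l n .H) (levelGen l n .E) (levelGen l n .F) i j := by
  rw [rMatrix, map_mul, level_expHH l n _ hij, level_qseries l n _ hij]
  rfl

theorem level_rMatrixInv (n : ℕ) {i j : Fin l} (hij : i ≠ j) :
    level (UhTensor l) n (rMatrixInv l i j) =
      qexpInv n (levelGen l n .F i * levelGen l n .E j) *
        hexp n (-((PowerSeries.C (1 / 4) : Qh) • (levelGen l n .H i * levelGen l n .H j))) := by
  rw [rMatrixInv, map_mul, level_expHH l n _ hij, level_qseries l n _ hij, ← neg_smul, ← map_neg,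
    ← neg_div]
  rfl

theorem rMatrix_mul_rMatrixInv {i j : Fin l} (hij : i ≠ j) :
    rMatrix l i j * rMatrixInv l i j = 1 := by
  refine ext_level fun n => ?_
  rw [map_mul, level_rMatrix l n hij, level_rMatrixInv l n hij, map_one,
    (quantumTriples_level l n).rElt_mul_inv]

theorem rMatrixInv_mul_rMatrix {i j : Fin l} (hij : i ≠ j) :
    rMatrixInv l i j * rMatrix l i j = 1 := by
  refine ext_level fun n => ?_
  rw [map_mul, level_rMatrix l n hij, level_rMatrixInv l n hij, map_one,
    (quantumTriples_level l n).inv_mul_rElt]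

theorem rMatrix_yangBaxter {i j k : Fin l} (hij : i ≠ j) (hik : i ≠ k) (hjk : j ≠ k) :
    rMatrix l i j * (rMatrix l i k * rMatrix l j k) =
      rMatrix l j k * (rMatrix l i k * rMatrix l i j) := by
  refine ext_level fun n => ?_
  simp only [map_mul, level_rMatrix l n hij, level_rMatrix l n hik, level_rMatrix l n hjk]
  exact (quantumTriples_level l n).yangBaxter hij hik hjk

theorem commute_rMatrix {i j k m : Fin l} (hij : i ≠ j) (hkm : k ≠ m) (hik : i ≠ k) (him : i ≠ m)
    (hjk : j ≠ k) (hjm : j ≠ m) : Commute (rMatrix l i j) (rMatrix l k m) := by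
  refine ext_level fun n => ?_
  rw [map_mul, map_mul, level_rMatrix l n hij, level_rMatrix l n hkm]
  exact (quantumTriples_level l n).commute_rElt_rElt hik him hjk hjm

end RMatrixHat

/-! ### The braid group action defined by the `R`-matrix -/

section BraidAction

variable {l : ℕ}

theorem leftPos_ne_rightPos (i : Fin (l - 1)) : leftPos i ≠ rightPos i := by
  simp [leftPos, rightPos, Fin.ext_iff]

/-- The transposition of the two positions of the crossing `σ_i`. -/
def crossSwap (i : Fin (l - 1)) : Equiv.Perm (Fin l) := Equiv.swap (leftPos i) (rightPos i)

/-- The generator `σ_i` acting on pairs `(π, x)`: the strand `π p` arrives at position `p`, and `x`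
is the product of the labels read so far. -/
def crossEquiv (i : Fin (l - 1)) : Equiv.Perm (Equiv.Perm (Fin l) × UhHat l) where
  toFun s := (s.1 * crossSwap i, rMatrix l (s.1 (leftPos i)) (s.1 (rightPos i)) * s.2)
  invFun s := (s.1 * crossSwap i, rMatrixInv l (s.1 (rightPos i)) (s.1 (leftPos i)) * s.2)
  left_inv s := by
    have h : s.1 (leftPos i) ≠ s.1 (rightPos i) := s.1.injective.ne (leftPos_ne_rightPos i)
    ext1
    · simp [crossSwap, mul_assoc]
    · simp [crossSwap, ← mul_assoc, rMatrixInv_mul_rMatrix l h]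
  right_inv s := by
    have h : s.1 (rightPos i) ≠ s.1 (leftPos i) := s.1.injective.ne (leftPos_ne_rightPos i).symm
    ext1
    · simp [crossSwap, mul_assoc]
    · simp [crossSwap, ← mul_assoc, rMatrix_mul_rMatrixInv l h]

theorem crossEquiv_comm {i j : Fin (l - 1)} (h : i.val + 2 ≤ j.val) :
    crossEquiv i * crossEquiv j = crossEquiv j * crossEquiv i := by
  have h1 : leftPos i ≠ leftPos j := by simp [leftPos, Fin.ext_iff]; omega
  have h2 : leftPos i ≠ rightPos j := by simp [leftPos, rightPos, Fin.ext_iff]; omega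
  have h3 : rightPos i ≠ leftPos j := by simp [leftPos, rightPos, Fin.ext_iff]; omega
  have h4 : rightPos i ≠ rightPos j := by simp [rightPos, Fin.ext_iff]; omega
  have hs : crossSwap j * crossSwap i = crossSwap i * crossSwap j :=
    (Equiv.Perm.Disjoint.commute (Equiv.Perm.disjoint_swap_swap (by
      simp [leftPos_ne_rightPos, h1.symm, h2.symm, h3.symm, h4.symm]))).eq
  refine Equiv.ext fun s => Prod.ext ?_ ?_
  · change s.1 * crossSwap j * crossSwap i = s.1 * crossSwap i * crossSwap j
    rw [mul_assoc, hs, mul_assoc]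
  · change rMatrix l (s.1 (crossSwap j (leftPos i))) (s.1 (crossSwap j (rightPos i))) *
        (rMatrix l (s.1 (leftPos j)) (s.1 (rightPos j)) * s.2) =
      rMatrix l (s.1 (crossSwap i (leftPos j))) (s.1 (crossSwap i (rightPos j))) *
        (rMatrix l (s.1 (leftPos i)) (s.1 (rightPos i)) * s.2)
    rw [crossSwap, crossSwap, Equiv.swap_apply_of_ne_of_ne h1 h2,
      Equiv.swap_apply_of_ne_of_ne h3 h4, Equiv.swap_apply_of_ne_of_ne h1.symm h3.symm,
      Equiv.swap_apply_of_ne_of_ne h2.symm h4.symm, ← mul_assoc, ← mul_assoc,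
      (commute_rMatrix l (s.1.injective.ne (leftPos_ne_rightPos i))
        (s.1.injective.ne (leftPos_ne_rightPos j)) (s.1.injective.ne h1) (s.1.injective.ne h2)
        (s.1.injective.ne h3) (s.1.injective.ne h4)).eq]

theorem crossEquiv_braid {i j : Fin (l - 1)} (h : i.val + 1 = j.val) :
    crossEquiv i * crossEquiv j * crossEquiv i = crossEquiv j * crossEquiv i * crossEquiv j := by
  have hm : leftPos j = rightPos i := by simp [leftPos, rightPos, h]
  have hab : leftPos i ≠ rightPos i := leftPos_ne_rightPos i
  have hbc : rightPos i ≠ rightPos j := hm ▸ leftPos_ne_rightPos j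
  have hac : leftPos i ≠ rightPos j := by simp [leftPos, rightPos, Fin.ext_iff]; omega
  have hsi : crossSwap i = Equiv.swap (leftPos i) (rightPos i) := rfl
  have hsj : crossSwap j = Equiv.swap (rightPos i) (rightPos j) := by rw [crossSwap, hm]
  have i1 : crossSwap i (leftPos i) = rightPos i := by rw [hsi, Equiv.swap_apply_left]
  have i2 : crossSwap i (rightPos i) = leftPos i := by rw [hsi, Equiv.swap_apply_right]
  have i3 : crossSwap i (rightPos j) = rightPos j := by
    rw [hsi, Equiv.swap_apply_of_ne_of_ne hac.symm hbc.symm]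
  have j1 : crossSwap j (leftPos i) = leftPos i := by
    rw [hsj, Equiv.swap_apply_of_ne_of_ne hab hac]
  have j2 : crossSwap j (rightPos i) = rightPos j := by rw [hsj, Equiv.swap_apply_left]
  have j3 : crossSwap j (rightPos j) = rightPos i := by rw [hsj, Equiv.swap_apply_right]
  refine Equiv.ext fun s => Prod.ext ?_ ?_
  · change s.1 * crossSwap i * crossSwap j * crossSwap i =
      s.1 * crossSwap j * crossSwap i * crossSwap j
    have hs : crossSwap i * crossSwap j * crossSwap i = crossSwap j * crossSwap i * crossSwap j := by
      have e1 : crossSwap i * crossSwap j * crossSwap i = Equiv.swap (leftPos i) (rightPos j) := by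
        rw [hsi, hsj, Equiv.swap_comm (leftPos i) (rightPos i),
          Equiv.swap_comm (rightPos i) (rightPos j)]
        exact Equiv.swap_mul_swap_mul_swap hbc.symm hac.symm
      have e2 : crossSwap j * crossSwap i * crossSwap j = Equiv.swap (leftPos i) (rightPos j) := by
        rw [hsi, hsj, Equiv.swap_mul_swap_mul_swap hab hac, Equiv.swap_comm]
      rw [e1, e2]
    simp only [mul_assoc] at hs ⊢
    rw [hs]
  · change rMatrix l (s.1 (crossSwap i (crossSwap j (leftPos i))))
          (s.1 (crossSwap i (crossSwap j (rightPos i)))) *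
        (rMatrix l (s.1 (crossSwap i (leftPos j))) (s.1 (crossSwap i (rightPos j))) *
          (rMatrix l (s.1 (leftPos i)) (s.1 (rightPos i)) * s.2)) =
      rMatrix l (s.1 (crossSwap j (crossSwap i (leftPos j))))
          (s.1 (crossSwap j (crossSwap i (rightPos j)))) *
        (rMatrix l (s.1 (crossSwap j (leftPos i))) (s.1 (crossSwap j (rightPos i))) *
          (rMatrix l (s.1 (leftPos j)) (s.1 (rightPos j)) * s.2))
    rw [hm, j1, j2, i1, i2, i3, j1, j3]
    have hY := rMatrix_yangBaxter l (s.1.injective.ne hab) (s.1.injective.ne hac)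
      (s.1.injective.ne hbc)
    rw [← mul_assoc, ← mul_assoc, mul_assoc (rMatrix l _ _) (rMatrix l _ _) (rMatrix l _ _), ← hY]
    simp only [mul_assoc]

/-- The action of the braid group on pairs `(π, x)` extending `crossEquiv`. -/
def braidAction : BraidGroup l →* Equiv.Perm (Equiv.Perm (Fin l) × UhHat l) :=
  PresentedGroup.toGroup (f := crossEquiv) (rels := braidRels l) (by
    rintro r (⟨i, j, h, rfl⟩ | ⟨i, j, h, rfl⟩)
    · rw [map_mul, map_inv, map_mul, map_mul, FreeGroup.lift_apply_of, FreeGroup.lift_apply_of,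
        crossEquiv_comm h, mul_inv_cancel]
    · rw [map_mul, map_inv, map_mul, map_mul, map_mul, map_mul, FreeGroup.lift_apply_of,
        FreeGroup.lift_apply_of, crossEquiv_braid h, mul_inv_cancel])

theorem braidAction_toBraid_cons_true (i : Fin (l - 1)) (w : BraidWord l) (s) :
    braidAction (BraidWord.toBraid ((i, true) :: w)) s =
      crossEquiv i (braidAction (BraidWord.toBraid w) s) := rfl

theorem braidAction_toBraid_cons_false (i : Fin (l - 1)) (w : BraidWord l) (s) :
    braidAction (BraidWord.toBraid ((i, false) :: w)) s =
      (crossEquiv i).symm (braidAction (BraidWord.toBraid w) s) := rfl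

/-- The universal invariant of a word is read off from the action of its braid, so it depends on
the braid only. -/
theorem braidAction_toBraid (w : BraidWord l) :
    braidAction w.toBraid (1, 1) = (strandAt w, universalInvariant w) := by
  induction w with
  | nil => rfl
  | cons x w ih =>
    obtain ⟨i, _ | _⟩ := x
    · rw [braidAction_toBraid_cons_false, ih]
      rfl
    · rw [braidAction_toBraid_cons_true, ih]
      rfl

/-- The permutation of a braid: `strand β p` is the strand of `β` which arrives at position `p`. -/
def strand (β : BraidGroup l) : Equiv.Perm (Fin l) := (braidAction β (1, 1)).1

/-- The invariant of a braid whose strands are labelled by `π` at the upper end points. -/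
def invariant (π : Equiv.Perm (Fin l)) (β : BraidGroup l) : UhHat l := (braidAction β (π, 1)).2

theorem universalInvariant_eq (w : BraidWord l) :
    universalInvariant w = invariant 1 w.toBraid := by
  rw [invariant, braidAction_toBraid]

theorem BraidWord.exists_toBraid (β : BraidGroup l) : ∃ w : BraidWord l, w.toBraid = β := by
  obtain ⟨x, rfl⟩ := PresentedGroup.mk_surjective _ β
  exact ⟨x.toWord, congrArg _ FreeGroup.mk_toWord⟩

/-- The action permutes the labels on the right and multiplies the labels read so far on the
left. -/
theorem braidAction_apply (β : BraidGroup l) (π : Equiv.Perm (Fin l)) (x : UhHat l) :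
    braidAction β (π, x) = (π * strand β, invariant π β * x) := by
  obtain ⟨w, rfl⟩ := BraidWord.exists_toBraid β
  have key : ∀ w : BraidWord l, ∀ π x, braidAction w.toBraid (π, x) =
      (π * strandAt w, (braidAction w.toBraid (π, 1)).2 * x) := by
    intro w
    induction w with
    | nil => exact fun π x => Prod.ext rfl (one_mul x).symm
    | cons y w ih =>
      intro π x
      obtain ⟨i, _ | _⟩ := y
      · rw [braidAction_toBraid_cons_false, braidAction_toBraid_cons_false, ih π x, ih π 1, mul_one]
        exact Prod.ext (mul_assoc _ _ _) (mul_assoc _ _ _).symm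
      · rw [braidAction_toBraid_cons_true, braidAction_toBraid_cons_true, ih π x, ih π 1, mul_one]
        exact Prod.ext (mul_assoc _ _ _) (mul_assoc _ _ _).symm
  rw [key, strand, braidAction_toBraid, invariant]

theorem strand_one : strand (1 : BraidGroup l) = 1 := rfl

theorem invariant_one (π : Equiv.Perm (Fin l)) : invariant π 1 = 1 := rfl

theorem strand_mul (β γ : BraidGroup l) : strand (β * γ) = strand γ * strand β := by
  rw [strand, map_mul, Equiv.Perm.mul_apply, braidAction_apply γ, braidAction_apply, one_mul]

theorem invariant_mul (π : Equiv.Perm (Fin l)) (β γ : BraidGroup l) :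
    invariant π (β * γ) = invariant (π * strand γ) β * invariant π γ := by
  rw [invariant, map_mul, Equiv.Perm.mul_apply, braidAction_apply γ, braidAction_apply, mul_one]

theorem strand_inv (β : BraidGroup l) : strand β⁻¹ = (strand β)⁻¹ := by
  rw [eq_inv_iff_mul_eq_one, ← strand_mul, mul_inv_cancel, strand_one]

theorem invariant_mul_inv (π : Equiv.Perm (Fin l)) (β : BraidGroup l) :
    invariant (π * strand β⁻¹) β * invariant π β⁻¹ = 1 := by
  rw [← invariant_mul, mul_inv_cancel, invariant_one]

theorem strand_of (i : Fin (l - 1)) :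
    strand (PresentedGroup.of (rels := braidRels l) i) = crossSwap i := by
  change 1 * crossSwap i = _
  rw [one_mul]

theorem invariant_of (π : Equiv.Perm (Fin l)) (i : Fin (l - 1)) :
    invariant π (PresentedGroup.of (rels := braidRels l) i) =
      rMatrix l (π (leftPos i)) (π (rightPos i)) := by
  change rMatrix l (π (leftPos i)) (π (rightPos i)) * 1 = _
  rw [mul_one]

end BraidAction

/-! ### Congruences modulo powers of `ħ` -/

namespace CongrModH

variable {A : Type} [Ring A] [Algebra Qh A] {n : ℕ} {x y z x' y' : A}

theorem refl (n : ℕ) (x : A) : CongrModH n x x := ⟨0, by rw [sub_self, smul_zero]⟩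

theorem of_eq (h : x = y) : CongrModH n x y := h ▸ refl n x

theorem trans (h : CongrModH n x y) (h' : CongrModH n y z) : CongrModH n x z := by
  obtain ⟨a, ha⟩ := h
  obtain ⟨b, hb⟩ := h'
  exact ⟨a + b, by rw [smul_add, ← ha, ← hb, sub_add_sub_cancel]⟩

theorem add (h : CongrModH n x y) (h' : CongrModH n x' y') : CongrModH n (x + x') (y + y') := by
  obtain ⟨a, ha⟩ := h
  obtain ⟨b, hb⟩ := h'
  exact ⟨a + b, by rw [smul_add, ← ha, ← hb, add_sub_add_comm]⟩

theorem mul (h : CongrModH n x y) (h' : CongrModH n x' y') : CongrModH n (x * x') (y * y') := by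
  obtain ⟨a, ha⟩ := h
  obtain ⟨b, hb⟩ := h'
  refine ⟨a * x' + y * b, ?_⟩
  rw [smul_add, ← smul_mul_assoc, ← mul_smul_comm, ← ha, ← hb]
  noncomm_ring

theorem smul_pow (k : ℕ) (h : CongrModH n x y) :
    CongrModH (k + n) ((hbar ^ k : Qh) • x) ((hbar ^ k : Qh) • y) := by
  obtain ⟨a, ha⟩ := h
  exact ⟨a, by rw [← smul_sub, ha, smul_smul, pow_add]⟩

theorem smul (c : Qh) (h : CongrModH n x y) : CongrModH n (c • x) (c • y) := by
  obtain ⟨a, ha⟩ := h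
  exact ⟨c • a, by rw [← smul_sub, ha, smul_comm]⟩

theorem mono {m : ℕ} (hmn : m ≤ n) (h : CongrModH n x y) : CongrModH m x y := by
  obtain ⟨a, ha⟩ := h
  exact ⟨(hbar ^ (n - m) : Qh) • a, by rw [ha, smul_smul, ← pow_add, Nat.add_sub_cancel' hmn]⟩

theorem map {B : Type} [Ring B] [Algebra Qh B] (φ : A →ₐ[Qh] B) (h : CongrModH n x y) :
    CongrModH n (φ x) (φ y) := by
  obtain ⟨a, ha⟩ := h
  exact ⟨φ a, by rw [← map_sub, ha, map_smul]⟩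

theorem add_smul_pow (x a : A) (n : ℕ) : CongrModH n (x + (hbar ^ n : Qh) • a) x :=
  ⟨a, add_sub_cancel_left _ _⟩

theorem exists_eq {m : ℕ} {a : A} (h : CongrModH (m + 1) x (1 + (hbar ^ m : Qh) • a)) :
    ∃ a', x = 1 + (hbar ^ m : Qh) • a' ∧ CongrModH 1 a' a := by
  obtain ⟨u, hu⟩ := h
  refine ⟨a + (hbar ^ 1 : Qh) • u, ?_, add_smul_pow _ _ _⟩
  rw [smul_add, smul_smul, ← pow_add, ← add_assoc, ← hu, add_sub_cancel]

/-- An inverse of an element congruent to `1` is congruent to `1`. -/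
theorem right_inv (h : CongrModH n x 1) (hx : x * x' = 1) : CongrModH n x' 1 := by
  obtain ⟨a, ha⟩ := h
  refine ⟨-(a * x'), ?_⟩
  rw [smul_neg, ← smul_mul_assoc, ← ha, sub_mul, hx, one_mul, neg_sub]

/-- A conjugate of `1 + ħⁿ a` is congruent to it modulo `ħⁿ⁺¹`, if the conjugating element is
congruent to `1` modulo `ħ`. -/
theorem conj {a : A} (hu : CongrModH 1 x 1) (hx : x * x' = 1)
    (hy : CongrModH (n + 1) y (1 + (hbar ^ n : Qh) • a)) :
    CongrModH (n + 1) (x * y * x') (1 + (hbar ^ n : Qh) • a) := by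
  obtain ⟨b, rfl, hb⟩ := hy.exists_eq
  rw [mul_add, mul_one, add_mul, hx, mul_smul_comm, smul_mul_assoc]
  refine (refl _ _).add (smul_pow n ?_)
  simpa using (hu.mul hb).mul (hu.right_inv hx)

theorem mul_one_add {a b : A} (hx : CongrModH 2 x (1 + (hbar ^ 1 : Qh) • a))
    (hy : CongrModH 2 y (1 + (hbar ^ 1 : Qh) • b)) :
    CongrModH 2 (x * y) (1 + (hbar ^ 1 : Qh) • (a + b)) := by
  refine (hx.mul hy).trans ⟨a * b, ?_⟩
  simp only [mul_add, add_mul, one_mul, mul_one, smul_mul_smul_comm, ← pow_add, smul_add,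
    one_add_one_eq_two]
  abel

/-- The group commutator of `1 + ħᵐ a` and `1 + ħ b` is `1 + ħᵐ⁺¹ [a, b]` to leading order. -/
theorem commutator {m : ℕ} (hm : 1 ≤ m) {a b : A} (hxx : x * x' = 1) (hyy : y * y' = 1)
    (hx : CongrModH (m + 1) x (1 + (hbar ^ m : Qh) • a))
    (hy : CongrModH (1 + 1) y (1 + (hbar ^ 1 : Qh) • b)) :
    CongrModH (m + 1 + 1) (x * y * x' * y') (1 + (hbar ^ (m + 1) : Qh) • (a * b - b * a)) := by
  have hx' : CongrModH 1 x' 1 := by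
    refine CongrModH.right_inv ?_ hxx
    exact (hx.mono (by omega)).trans ((add_smul_pow 1 a m).mono hm)
  have hy' : CongrModH 1 y' 1 := by
    refine CongrModH.right_inv ?_ hyy
    exact (hy.mono (by omega)).trans (add_smul_pow 1 b 1)
  obtain ⟨a', ha, haa⟩ := hx.exists_eq
  obtain ⟨b', hb, hbb⟩ := hy.exists_eq
  have hcomm : x * y - y * x = (hbar ^ (m + 1) : Qh) • (a' * b' + -1 * (b' * a')) := by
    rw [ha, hb]
    simp only [mul_add, add_mul, one_mul, mul_one, smul_mul_smul_comm, neg_mul, ← pow_add,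
      add_comm 1 m, smul_add, smul_neg]
    abel
  have hsplit : x * y * x' * y' = 1 + (x * y - y * x) * (x' * y') := by
    have h1 : y * x * (x' * y') = 1 := by
      rw [mul_assoc, ← mul_assoc x, hxx, one_mul, hyy]
    rw [sub_mul, h1, add_sub_cancel, mul_assoc, mul_assoc]
  rw [hsplit, hcomm, smul_mul_assoc]
  refine (refl _ _).add (smul_pow (m + 1) ?_)
  have := ((haa.mul hbb).add ((refl 1 (-1)).mul (hbb.mul haa))).mul (hx'.mul hy')
  simpa [sub_eq_add_neg] using this

end CongrModH

/-! ### First order terms of the `R`-matrix -/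

section LeadingTerms

variable {l : ℕ}

/-- The Casimir tensor `½ h ⊗ h + f ⊗ e + e ⊗ f` placed in the tensorands `i` and `j`. -/
def casimirAt (l : ℕ) (i j : Fin l) : UhHat l :=
  (1 / 2 : ℚ) • (inHat l i (Uh.gen .H) * inHat l j (Uh.gen .H)) +
    inHat l i (Uh.gen .F) * inHat l j (Uh.gen .E) + inHat l i (Uh.gen .E) * inHat l j (Uh.gen .F)

theorem casimirAt_comm {i j : Fin l} (h : i ≠ j) : casimirAt l i j = casimirAt l j i := by
  rw [casimirAt, casimirAt, (commute_inHat l h _ _).eq, (commute_inHat l h (Uh.gen .F) _).eq,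
    (commute_inHat l h (Uh.gen .E) _).eq, add_right_comm]

theorem rat_smul_eq {A : Type} [Ring A] [Algebra Qh A] (t : ℚ) (x : HCompletion A) :
    t • x = (PowerSeries.C t : Qh) • x := rfl

/-- The first order term of the `R`-matrix. -/
def rLinear (l : ℕ) (i j : Fin l) : UhHat l :=
  (1 / 4 : ℚ) • (inHat l i (Uh.gen .H) * inHat l j (Uh.gen .H)) +
    inHat l i (Uh.gen .F) * inHat l j (Uh.gen .E)

theorem expHH_congr (t : ℚ) (i j : Fin l) : CongrModH 2 (expHH l t i j)
    (1 + (hbar ^ 1 : Qh) • t • (inHat l i (Uh.gen .H) * inHat l j (Uh.gen .H))) := by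
  rw [expHH, hSum_eq_add 2, Finset.sum_range_succ, Finset.sum_range_one]
  refine (CongrModH.add_smul_pow _ _ 2).trans (CongrModH.of_eq ?_)
  simp only [map_smul, map_mul, pow_zero, pow_one, one_smul, mul_one, map_one, div_one,
    Nat.factorial_zero, Nat.factorial_one, Nat.cast_one, rat_smul_eq]
  rfl

theorem constantCoeff_qInvHalf : PowerSeries.constantCoeff qInvHalf = 1 := by
  rw [← PowerSeries.coeff_zero_eq_constantCoeff_apply, qInvHalf, PowerSeries.coeff_rescale]
  simp

theorem constantCoeff_rCoeff_one : PowerSeries.constantCoeff (rCoeff 1) = 1 := by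
  simp [rCoeff, constantCoeff_qInvHalf, constantCoeff_qFactorial, qSubOneDiv]

theorem CongrModH.smul_of_constantCoeff {A : Type} [Ring A] [Algebra Qh A] {c : Qh}
    (hc : PowerSeries.constantCoeff c = 1) (x : A) : CongrModH 1 (c • x) x := by
  obtain ⟨g, hg⟩ : (PowerSeries.X : Qh) ∣ c - 1 := by
    rw [PowerSeries.X_dvd_iff, map_sub, hc, map_one, sub_self]
  refine ⟨g • x, ?_⟩
  rw [smul_smul, pow_one, ← hg, sub_smul, one_smul]

theorem rMatrix_congr (i j : Fin l) :
    CongrModH 2 (rMatrix l i j) (1 + (hbar ^ 1 : Qh) • rLinear l i j) := by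
  have h2 : CongrModH 2 (hSum fun n => rCoeff n •
      ((inTensor l i (Uh.gen .F)) ^ n * (inTensor l j (Uh.gen .E)) ^ n))
      (1 + (hbar ^ 1 : Qh) • (inHat l i (Uh.gen .F) * inHat l j (Uh.gen .E))) := by
    rw [hSum_eq_add 2, Finset.sum_range_succ, Finset.sum_range_one]
    refine (CongrModH.add_smul_pow _ _ 2).trans ?_
    simp only [map_smul, map_mul, pow_zero, pow_one, one_smul, mul_one, map_one, rCoeff_zero]
    refine (CongrModH.refl _ _).add ?_
    have h := (CongrModH.smul_of_constantCoeff constantCoeff_rCoeff_one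
      (inHat l i (Uh.gen .F) * inHat l j (Uh.gen .E))).smul_pow 1
    rw [pow_one] at h
    exact h
  exact (expHH_congr (1 / 4) i j).mul_one_add h2

end LeadingTerms

/-! ### The Lie bracket of `sl₂` modulo `ħ` -/

section Bracket

theorem sl2ToUh_h : sl2ToUh sl2h = Uh.gen .H := by
  simp [sl2ToUh, sl2h]

theorem sl2ToUh_e : sl2ToUh sl2e = Uh.gen .E := by
  simp [sl2ToUh, sl2e]

theorem sl2ToUh_f : sl2ToUh sl2f = Uh.gen .F := by
  simp [sl2ToUh, sl2f]

theorem commutator_of_combination {A : Type*} [Ring A] [Algebra ℚ A] (H E F : A)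
    (a b c a' b' c' : ℚ) :
    (a • H + b • E + c • F) * (a' • H + b' • E + c' • F) -
      (a' • H + b' • E + c' • F) * (a • H + b • E + c • F) =
    (a * b' - b * a') • (H * E - E * H) + (a * c' - c * a') • (H * F - F * H) +
      (b * c' - c * b') • (E * F - F * E) := by
  simp only [mul_add, add_mul, smul_mul_smul_comm]
  module

/-- `sl2ToUh` is a Lie algebra homomorphism modulo `ħ`. -/
theorem sl2ToUh_bracket (x y : Sl2) :
    CongrModH 1 (sl2ToUh x * sl2ToUh y - sl2ToUh y * sl2ToUh x) (sl2ToUh ⁅x, y⁆) := by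
  obtain ⟨z, hz⟩ := Uh.exists_EF_eq
  have htr : ∀ x : Sl2, x.val 1 1 = -x.val 0 0 := fun x => by
    have := LinearMap.mem_ker.mp x.2
    rw [Matrix.traceLinearMap_apply, Matrix.trace_fin_two] at this
    linarith
  have hb : ∀ i j, (⁅x, y⁆ : Sl2).val i j = (x.val * y.val - y.val * x.val) i j := fun _ _ => rfl
  have hleft : sl2ToUh x * sl2ToUh y - sl2ToUh y * sl2ToUh x = _ :=
    commutator_of_combination (Uh.gen .H) (Uh.gen .E) (Uh.gen .F) (x.val 0 0) (x.val 0 1)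
      (x.val 1 0) (y.val 0 0) (y.val 0 1) (y.val 1 0)
  have hright : sl2ToUh ⁅x, y⁆ = (⁅x, y⁆ : Sl2).val 0 0 • Uh.gen .H +
    (⁅x, y⁆ : Sl2).val 0 1 • Uh.gen .E + (⁅x, y⁆ : Sl2).val 1 0 • Uh.gen .F := rfl
  refine ⟨(x.val 0 1 * y.val 1 0 - x.val 1 0 * y.val 0 1) • z, ?_⟩
  rw [hleft, hright, hb, hb, hb, Uh.gen_HE, Uh.gen_HF, hz, pow_one, smul_comm (hbar : Qh)]
  generalize (hbar : Qh) • z = z'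
  simp only [Matrix.sub_apply, Matrix.mul_apply, Fin.sum_univ_two, htr, two_mul]
  module

end Bracket

/-! ### Commutators with the Casimir tensor -/

section Placement

variable {l : ℕ}

theorem place_tprod {n : ℕ} (J : Fin n → Fin l) (v : Fin n → Sl2) :
    place l J (PiTensorProduct.tprod ℚ v) =
      (List.ofFn fun p => inHat l (J p) (sl2ToUh (v p))).prod := by
  rw [place, PiTensorProduct.lift.tprod]
  rfl

theorem place_mulEquiv {n m : ℕ} (J : Fin (n + m) → Fin l) (a : (⨂[ℚ]^n) Sl2)
    (b : (⨂[ℚ]^m) Sl2) :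
    place l J (TensorPower.mulEquiv (a ⊗ₜ[ℚ] b)) =
      place l (fun i => J (Fin.castAdd m i)) a * place l (fun i => J (Fin.natAdd n i)) b := by
  induction a using PiTensorProduct.induction_on with
  | add x y hx hy => rw [TensorProduct.add_tmul, map_add, map_add, hx, hy, map_add, add_mul]
  | smul_tprod r v =>
    induction b using PiTensorProduct.induction_on with
    | add x y hx hy => rw [TensorProduct.tmul_add, map_add, map_add, hx, hy, map_add, mul_add]
    | smul_tprod s w =>
      rw [TensorProduct.smul_tmul_smul, map_smul, map_smul, map_smul, map_smul, smul_mul_smul_comm,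
        ← TensorPower.gMul_def, TensorPower.tprod_mul_tprod, place_tprod, place_tprod, place_tprod,
        ← List.prod_append, ← List.ofFn_fin_append]
      congr 3
      funext p
      refine Fin.addCases (fun i => ?_) (fun i => ?_) p
      · simp only [Fin.append_left]
      · simp only [Fin.append_right]

theorem commute_place {n : ℕ} {J : Fin n → Fin l} {z : UhHat l}
    (h : ∀ p x, Commute (inHat l (J p) x) z) (t : (⨂[ℚ]^n) Sl2) : Commute (place l J t) z := by
  induction t using PiTensorProduct.induction_on with
  | add x y hx hy => rw [map_add]; exact hx.add_left hy
  | smul_tprod r v =>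
    rw [map_smul, place_tprod]
    refine Commute.smul_left (Commute.list_prod_left _ _ fun y hy => ?_) r
    obtain ⟨p, rfl⟩ := (List.mem_ofFn' _ _).mp hy
    exact h p _

theorem place_tensorRight (J : Fin 2 → Fin l) (b a : Sl2) :
    place l J (tensorRight b a) = inHat l (J 0) (sl2ToUh a) * inHat l (J 1) (sl2ToUh b) := by
  change place l J (PiTensorProduct.tprod ℚ ![a, b]) = _
  rw [place_tprod]
  simp

theorem place_casimir (J : Fin 2 → Fin l) : place l J casimir = casimirAt l (J 0) (J 1) := by
  rw [casimir, map_add, map_add, map_smul, place_tensorRight, place_tensorRight, place_tensorRight,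
    sl2ToUh_h, sl2ToUh_e, sl2ToUh_f, casimirAt]

/-- Modulo `ħ`, the map `s` is the commutator with the Casimir tensor. -/
theorem commutator_casimirAt {p r : Fin l} (hpr : p ≠ r) (x : Sl2) :
    CongrModH 1 (inHat l p (sl2ToUh x) * casimirAt l p r - casimirAt l p r * inHat l p (sl2ToUh x))
      (place l ![p, r] (sMap x)) := by
  have hterm : ∀ y z : Sl2, CongrModH 1
      (inHat l p (sl2ToUh x) * (inHat l p (sl2ToUh y) * inHat l r (sl2ToUh z)) -
        (inHat l p (sl2ToUh y) * inHat l r (sl2ToUh z)) * inHat l p (sl2ToUh x))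
      (place l ![p, r] ((tensorRight z ∘ₗ bracketRight y) x)) := fun y z => by
    rw [mul_assoc (inHat l p (sl2ToUh y)), ← (commute_inHat l hpr (sl2ToUh x) _).eq, ← mul_assoc,
      ← mul_assoc, ← sub_mul, ← map_mul (inHat l p), ← map_mul (inHat l p), ← map_sub]
    refine (((sl2ToUh_bracket x y).map (inHat l p)).mul (CongrModH.refl 1 _)).trans
      (CongrModH.of_eq ?_)
    exact (place_tensorRight ![p, r] z ⁅x, y⁆).symm
  have hH := (hterm sl2h sl2h).smul (PowerSeries.C (1 / 2))
  have h := (hH.add (hterm sl2f sl2e)).add (hterm sl2e sl2f)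
  rw [sl2ToUh_h, sl2ToUh_e, sl2ToUh_f] at h
  rw [sMap, LinearMap.add_apply, LinearMap.add_apply, LinearMap.smul_apply, map_add, map_add,
    map_smul, rat_smul_eq, casimirAt, rat_smul_eq]
  refine (CongrModH.of_eq ?_).trans h
  rw [mul_add, mul_add, add_mul, add_mul, smul_sub, mul_smul_comm, smul_mul_assoc]
  abel

/-- Elements `a ⊗ x` with a single last factor `x` span the tensor power. -/
theorem tensorPower_succ_induction {n : ℕ} {P : (⨂[ℚ]^(n + 1)) Sl2 → Prop}
    (hP0 : P 0) (hadd : ∀ x y, P x → P y → P (x + y))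
    (htmul : ∀ (a : (⨂[ℚ]^n) Sl2) (x : Sl2),
      P (TensorPower.mulEquiv (a ⊗ₜ[ℚ] PiTensorProduct.tprod ℚ fun _ : Fin 1 => x))) (t) : P t := by
  obtain ⟨y, rfl⟩ := (TensorPower.mulEquiv (R := ℚ) (M := Sl2) (n := n) (m := 1)).surjective t
  induction y using TensorProduct.induction_on with
  | zero => rw [map_zero]; exact hP0
  | add x y hx hy => rw [map_add]; exact hadd _ _ hx hy
  | tmul a b =>
    obtain ⟨x, rfl⟩ := (PiTensorProduct.subsingletonEquiv (R := ℚ)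
      (s := fun _ : Fin 1 => Sl2) (0 : Fin 1)).symm.surjective b
    rw [PiTensorProduct.subsingletonEquiv_symm_apply']
    exact htmul a x

theorem sLast_mulEquiv {n : ℕ} (a : (⨂[ℚ]^n) Sl2) (x : Sl2) :
    sLast n (TensorPower.mulEquiv (a ⊗ₜ[ℚ] PiTensorProduct.tprod ℚ fun _ : Fin 1 => x)) =
      TensorPower.mulEquiv (a ⊗ₜ[ℚ] sMap x) := by
  rw [sLast, LinearMap.comp_apply, LinearMap.comp_apply, LinearEquiv.coe_coe, LinearEquiv.coe_coe,
    LinearEquiv.symm_apply_apply, TensorProduct.map_tmul, LinearMap.comp_apply,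
    LinearEquiv.coe_coe, PiTensorProduct.subsingletonEquiv_apply_tprod, LinearMap.id_apply]

/-- Modulo `ħ`, commutation with the Casimir tensor in the last two tensorands realises
`1^{⊗ n} ⊗ s`. -/
theorem commutator_place {n : ℕ} {J : Fin (n + 2) → Fin l} (hJ : Function.Injective J)
    (t : (⨂[ℚ]^(n + 1)) Sl2) :
    CongrModH 1
      (place l (fun i => J i.castSucc) t *
          casimirAt l (J (Fin.last n).castSucc) (J (Fin.last (n + 1))) -
        casimirAt l (J (Fin.last n).castSucc) (J (Fin.last (n + 1))) *
          place l (fun i => J i.castSucc) t)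
      (place l J (sLast n t)) := by
  induction t using tensorPower_succ_induction with
  | hP0 =>
    rw [map_zero, map_zero, map_zero, zero_mul, mul_zero, sub_zero]
    exact CongrModH.refl _ _
  | hadd x y hx hy =>
    rw [map_add, map_add, map_add, add_mul, mul_add, add_sub_add_comm]
    exact hx.add hy
  | htmul a x =>
    have hp : J (Fin.last n).castSucc ≠ J (Fin.last (n + 1)) :=
      hJ.ne (Fin.castSucc_lt_last _).ne
    set c := casimirAt l (J (Fin.last n).castSucc) (J (Fin.last (n + 1)))
    have hlast : place l (fun i : Fin 1 => J (Fin.natAdd n i).castSucc)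
        (PiTensorProduct.tprod ℚ fun _ => x) =
        inHat l (J (Fin.last n).castSucc) (sl2ToUh x) := by
      rw [place_tprod, List.ofFn_succ, List.ofFn_zero, List.prod_singleton]
      rfl
    have hcomm : Commute (place l (fun i : Fin n => J (Fin.castAdd 1 i).castSucc) a) c := by
      refine commute_place (fun i y => ?_) a
      have h1 : J (Fin.castAdd 1 i).castSucc ≠ J (Fin.last n).castSucc :=
        hJ.ne fun h => (Fin.castSucc_lt_last i).ne (Fin.castSucc_injective _ h)
      have h2 : J (Fin.castAdd 1 i).castSucc ≠ J (Fin.last (n + 1)) :=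
        hJ.ne (Fin.castSucc_lt_last _).ne
      have h3 : ∀ u v, Commute (inHat l (J (Fin.castAdd 1 i).castSucc) y)
          (inHat l (J (Fin.last n).castSucc) u * inHat l (J (Fin.last (n + 1))) v) := fun u v =>
        (commute_inHat l h1 _ _).mul_right (commute_inHat l h2 _ _)
      exact (((h3 _ _).smul_right _).add_right (h3 _ _)).add_right (h3 _ _)
    have hJ2 : (fun i : Fin 2 => J (Fin.natAdd n i)) =
        ![J (Fin.last n).castSucc, J (Fin.last (n + 1))] := by
      funext i
      fin_cases i <;> rfl
    rw [sLast_mulEquiv, place_mulEquiv, place_mulEquiv (m := 2) J, hlast, hJ2, ← mul_assoc c,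
      ← hcomm.eq, mul_assoc, mul_assoc, ← mul_sub]
    exact (CongrModH.refl 1 _).mul (commutator_casimirAt hp x)

end Placement

/-! ### The invariant of iterated commutators of pure braids -/

section PureBraids

variable {l : ℕ}

theorem invariant_of_congr_one (π : Equiv.Perm (Fin l)) (i : Fin (l - 1)) :
    CongrModH 1 (invariant π (PresentedGroup.of (rels := braidRels l) i)) 1 := by
  rw [invariant_of]
  exact ((rMatrix_congr _ _).mono one_le_two).trans (CongrModH.add_smul_pow _ _ 1)

theorem rMatrix_mul_rMatrix_congr {i j : Fin l} (h : i ≠ j) :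
    CongrModH 2 (rMatrix l j i * rMatrix l i j) (1 + (hbar ^ 1 : Qh) • casimirAt l i j) := by
  refine ((rMatrix_congr j i).mul_one_add (rMatrix_congr i j)).trans (CongrModH.of_eq ?_)
  rw [rLinear, rLinear, casimirAt, (commute_inHat l h.symm _ _).eq,
    (commute_inHat l h.symm (Uh.gen .F) _).eq]
  congr 2
  module

/-- The invariant of the full twist of two adjacent strands. -/
theorem sigma_sq (π : Equiv.Perm (Fin l)) (i : Fin (l - 1)) :
    strand (PresentedGroup.of (rels := braidRels l) i ^ 2) = 1 ∧
    CongrModH 2 (invariant π (PresentedGroup.of (rels := braidRels l) i ^ 2))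
      (1 + (hbar ^ 1 : Qh) • casimirAt l (π (leftPos i)) (π (rightPos i))) := by
  constructor
  · rw [pow_two, strand_mul, strand_of, crossSwap, Equiv.swap_mul_self]
  · rw [pow_two, invariant_mul, strand_of, invariant_of, invariant_of, Equiv.Perm.mul_apply,
      Equiv.Perm.mul_apply, crossSwap, Equiv.swap_apply_left, Equiv.swap_apply_right]
    exact rMatrix_mul_rMatrix_congr (π.injective.ne (leftPos_ne_rightPos i))

theorem pureGenAux_succ (i j : ℕ) (h : i < j) :
    pureGenAux l i (j + 1) = sigma l j * pureGenAux l i j * (sigma l j)⁻¹ := by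
  obtain ⟨d, rfl⟩ := Nat.exists_eq_add_of_lt h
  have h1 : i + d + 1 + 1 - 1 - i = d + 1 := by omega
  have h2 : i + d + 1 - 1 - i = d := by omega
  have h3 : ∀ t, i + d + 1 + 1 - 1 - (t + 1) = i + d + 1 - 1 - t := fun t => by omega
  simp only [pureGenAux, h1, h2, List.range_succ_eq_map, List.map_cons, List.map_map,
    Function.comp_def, List.prod_cons, h3, Nat.succ_eq_add_one, mul_inv_rev, mul_assoc]
  rfl

theorem pureGenAux_congr (i : ℕ) (d : ℕ) (hj : i + d + 1 < l) (π : Equiv.Perm (Fin l)) :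
    strand (pureGenAux l i (i + d + 1)) = 1 ∧
    CongrModH 2 (invariant π (pureGenAux l i (i + d + 1)))
      (1 + (hbar ^ 1 : Qh) • casimirAt l (π ⟨i, by omega⟩) (π ⟨i + d + 1, hj⟩)) := by
  induction d generalizing π with
  | zero =>
    have h : pureGenAux l i (i + 0 + 1) =
        PresentedGroup.of (rels := braidRels l) ⟨i, by omega⟩ ^ 2 := by
      simp [pureGenAux, sigma, show i < l - 1 by omega]
    rw [h]
    exact sigma_sq π ⟨i, by omega⟩
  | succ d ih =>
    obtain ⟨k, hk⟩ : ∃ k : Fin (l - 1), k.val = i + d + 1 := ⟨⟨i + d + 1, by omega⟩, rfl⟩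
    have hs : sigma l (i + d + 1) = PresentedGroup.of (rels := braidRels l) k := by
      rw [sigma, dif_pos (by omega)]
      congr 1
      exact Fin.ext hk.symm
    set π' := π * strand (PresentedGroup.of (rels := braidRels l) k)⁻¹ with hπ'
    have hπ'' : π' = π * crossSwap k := by
      rw [hπ', strand_inv, strand_of, crossSwap, Equiv.swap_inv]
    obtain ⟨ih1, ih2⟩ := ih (by omega) π'
    have hrec := pureGenAux_succ (l := l) i (i + d + 1) (by omega)
    rw [hs] at hrec
    rw [show pureGenAux l i (i + (d + 1) + 1) = _ from hrec]
    refine ⟨?_, ?_⟩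
    · rw [strand_mul, strand_mul, ih1, one_mul, strand_inv, inv_mul_cancel]
    · rw [invariant_mul, invariant_mul, ← hπ', ih1, mul_one]
      have e1 : π' ⟨i, by omega⟩ = π ⟨i, by omega⟩ := by
        rw [hπ'', Equiv.Perm.mul_apply, crossSwap, Equiv.swap_apply_of_ne_of_ne]
        · simp [leftPos, Fin.ext_iff]; omega
        · simp [rightPos, Fin.ext_iff]; omega
      have e2 : π' ⟨i + d + 1, by omega⟩ = π ⟨i + d + 1 + 1, by omega⟩ := by
        have h1 : (⟨i + d + 1, by omega⟩ : Fin l) = leftPos k := Fin.ext hk.symm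
        have h2 : (⟨i + d + 1 + 1, by omega⟩ : Fin l) = rightPos k := Fin.ext (by simp [rightPos, hk])
        rw [hπ'', Equiv.Perm.mul_apply, h1, crossSwap, Equiv.swap_apply_left, ← h2]
      rw [e1, e2] at ih2
      exact CongrModH.conj (n := 1) (invariant_of_congr_one _ _) (invariant_mul_inv π _) ih2

theorem pureGen_congr {i j : Fin l} (h : i ≠ j) (π : Equiv.Perm (Fin l)) :
    strand (pureGen i j) = 1 ∧
    CongrModH 2 (invariant π (pureGen i j))
      (1 + (hbar ^ 1 : Qh) • casimirAt l (π i) (π j)) := by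
  have key : ∀ i j : Fin l, i < j → strand (pureGenAux l i j) = 1 ∧
      CongrModH 2 (invariant π (pureGenAux l i j))
        (1 + (hbar ^ 1 : Qh) • casimirAt l (π i) (π j)) := by
    rintro ⟨i, hi⟩ ⟨j, hj⟩ hij
    obtain ⟨d, rfl⟩ := Nat.exists_eq_add_of_lt (show i < j from hij)
    exact pureGenAux_congr i d hj π
  rw [pureGen]
  split_ifs with hij
  · exact key i j hij
  · rw [casimirAt_comm (π.injective.ne h)]
    exact key j i (lt_of_le_of_ne (not_lt.mp hij) h.symm)

theorem invariant_mul_inv_of_pure {β : BraidGroup l} (h : strand β = 1) :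
    invariant 1 β * invariant 1 β⁻¹ = 1 := by
  have := invariant_mul_inv 1 β
  rwa [strand_inv, h, inv_one, one_mul] at this

theorem commBraid_congr (m : ℕ) (J : Fin (m + 2) → Fin l) (hJ : Function.Injective J) :
    strand (commBraid (m + 1) J) = 1 ∧
    CongrModH (m + 2) (invariant 1 (commBraid (m + 1) J))
      (1 + (hbar ^ (m + 1) : Qh) • place l J (varsigma (m + 1))) := by
  induction m with
  | zero =>
    change strand (pureGen (J 0) (J 1)) = 1 ∧ CongrModH 2 (invariant 1 (pureGen (J 0) (J 1)))
      (1 + (hbar ^ 1 : Qh) • place l J casimir)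
    rw [place_casimir]
    exact pureGen_congr (hJ.ne (by decide)) 1
  | succ m ih =>
    obtain ⟨hx1, hx⟩ := ih (fun i => J i.castSucc) fun a b h => Fin.castSucc_injective _ (hJ h)
    obtain ⟨hy1, hy⟩ := pureGen_congr (i := J (Fin.last (m + 1)).castSucc)
      (j := J (Fin.last (m + 2))) (hJ.ne (Fin.castSucc_lt_last _).ne) 1
    change strand (commBraid (m + 1) (fun i => J i.castSucc) *
        pureGen (J (Fin.last (m + 1)).castSucc) (J (Fin.last (m + 2))) *
        (commBraid (m + 1) (fun i => J i.castSucc))⁻¹ *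
        (pureGen (J (Fin.last (m + 1)).castSucc) (J (Fin.last (m + 2))))⁻¹) = 1 ∧
      CongrModH (m + 3) (invariant 1 (commBraid (m + 1) (fun i => J i.castSucc) *
        pureGen (J (Fin.last (m + 1)).castSucc) (J (Fin.last (m + 2))) *
        (commBraid (m + 1) (fun i => J i.castSucc))⁻¹ *
        (pureGen (J (Fin.last (m + 1)).castSucc) (J (Fin.last (m + 2))))⁻¹))
      (1 + (hbar ^ (m + 2) : Qh) • place l J (sLast (m + 1) (varsigma (m + 1))))
    set x := commBraid (m + 1) (fun i => J i.castSucc)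
    set y := pureGen (J (Fin.last (m + 1)).castSucc) (J (Fin.last (m + 2)))
    constructor
    · simp only [strand_mul, strand_inv, hx1, hy1, inv_one, mul_one]
    · simp only [invariant_mul, strand_inv, hx1, hy1, inv_one, mul_one]
      refine (CongrModH.commutator (by omega) (invariant_mul_inv_of_pure hx1)
        (invariant_mul_inv_of_pure hy1) hx hy).trans ?_
      exact (CongrModH.refl _ _).add ((commutator_place hJ _).smul_pow (m + 2))

end PureBraids

end UniversalSl2

end

theorem proposition6p2 (l m : ℕ) (hm : 1 ≤ m) (J : Fin (m + 1) → Fin l)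
    (hJ : J ∈ UniversalSl2.indexSet l (m + 1))
    (w : UniversalSl2.BraidWord l) (hw : w.toBraid = UniversalSl2.commBraid m J) :
    UniversalSl2.CongrModH (m + 1) (UniversalSl2.universalInvariant w)
      (1 + (UniversalSl2.hbar ^ m : UniversalSl2.Qh) •
        UniversalSl2.place l J (UniversalSl2.varsigma m)) := by
  obtain ⟨k, rfl⟩ := Nat.exists_eq_add_of_le' hm
  rw [UniversalSl2.universalInvariant_eq, hw]
  exact (UniversalSl2.commBraid_congr k J hJ.1).2
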